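/- Let $A$ be an $n\times n$ complex matrix ($n\ge 1$) that is symmetric ($A=A^{T}$) and banded with bandwidth $w\ge 0$, i.e. $A_{ij}=0$ whenever $|i-j|>w$. Let $s=(s_1,\dots,s_n)$ be a vector of positive integers, put $c:=\max_i s_i$, and let $A_s$ be the symmetric matrix obtained from $A$ by repeating the $i$-th row and column $s_i$ times. The loop hafnian of a symmetric matrix $B$ with rows and columns indexed by a finite set $V$ is $\operatorname{lhaf}(B)=\sum_{\pi}\prod_{ij\in\pi}B_{ij}$, where $\pi$ ranges over the perfect matchings of the complete graph with loops on $V$ (sets of edges and loops such that every vertex lies on exactly one of them). Then $\operatorname{lhaf}(A_s)$ can be computed from $(n,w,s,A)$ in time $O^{*}\bigl(n\,(2c+2)^{2w+1}\bigr)$. Precisely: there are one program for a unit-cost random access machine with exact complex arithmetic (the operations $+,-,\times,\div$ on complex numbers, addition, truncated subtraction and comparison of natural numbers, indirect addressing and jumps; each executed instruction costs one unit of time) and absolute constants $K,k\in\mathbb N$ such that, for all $n$, $w$, $A$ and $s$ as above, the program started on input $(n,w,s,A)$, with the entries of $A$ and $s$ stored in memory, halts with output $\operatorname{lhaf}(A_s)$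 after at most $$K\cdot n\,(2c+2)^{2w+1}\cdot\bigl\lfloor\log_2\bigl((2c+2)^{2w+1}\bigr)\bigr\rfloor^{k}$$ steps. -/

import Mathlib

namespace LoopHaf

/-- `A i j = 0` whenever `|i - j| > w`. -/
def IsBanded {n : ℕ} (A : Matrix (Fin n) (Fin n) ℂ) (w : ℕ) : Prop :=
  ∀ i j : Fin n, (w : ℤ) < |(i : ℤ) - (j : ℤ)| → A i j = 0

/-- The perfect matchings of the complete graph with loops on `V`: the sets of edges (unordered
pairs of vertices, a loop being the pair `s(v, v)`) such that every vertex lies on exactly one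
edge of the set. -/
def perfectMatchings (V : Type*) [Fintype V] [DecidableEq V] : Finset (Finset (Sym2 V)) :=
  Finset.univ.filter fun π => ∀ v : V, (π.filter fun e => v ∈ e).card = 1

/-- The weight `A i j` of the edge `ij`. -/
def edgeWeight {V : Type*} (A : Matrix V V ℂ) (hA : A.IsSymm) : Sym2 V → ℂ :=
  Sym2.lift ⟨fun i j => A i j, fun i j => hA.apply j i⟩

/-- The loop hafnian of a symmetric matrix. -/
def lhaf {V : Type*} [Fintype V] [DecidableEq V] (A : Matrix V V ℂ) (hA : A.IsSymm) : ℂ :=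
  ∑ π ∈ perfectMatchings V, ∏ e ∈ π, edgeWeight A hA e

/-- `A` with its `i`-th row and column repeated `s i` times; the index `⟨i, l⟩` is the `l`-th
copy of `i`. -/
def repeated {n : ℕ} (A : Matrix (Fin n) (Fin n) ℂ) (s : Fin n → ℕ) :
    Matrix (Σ i : Fin n, Fin (s i)) (Σ i : Fin n, Fin (s i)) ℂ :=
  A.submatrix Sigma.fst Sigma.fst

theorem repeated_isSymm {n : ℕ} {A : Matrix (Fin n) (Fin n) ℂ} (hA : A.IsSymm)
    (s : Fin n → ℕ) : (repeated A s).IsSymm :=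
  hA.submatrix Sigma.fst

/-! A unit-cost random access machine with exact complex arithmetic. It has index registers and an
index memory, which hold natural numbers, and scalar registers and a scalar memory, which hold
complex numbers. Memory cells are addressed indirectly, through an index register. The only
operations on natural numbers are addition and (truncated) subtraction, and only comparisons of
natural numbers can influence the flow of control. -/

inductive Instr where
  /-- index register `d` gets the constant `k` -/
  | iconst (d k : ℕ)
  /-- `d := a + b` on index registers -/
  | iadd (d a b : ℕ)
  /-- `d := a - b` on index registers, or `0` if `a < b` -/
  | isub (d a b : ℕ)
  /-- index register `d` gets the index memory cell whose address is in index register `a` -/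
  | iload (d a : ℕ)
  /-- the index memory cell whose address is in index register `a` gets index register `b` -/
  | istore (a b : ℕ)
  /-- scalar register `d` gets the constant `k` -/
  | cconst (d k : ℕ)
  /-- `d := a + b` on scalar registers -/
  | cadd (d a b : ℕ)
  /-- `d := a - b` on scalar registers -/
  | csub (d a b : ℕ)
  /-- `d := a * b` on scalar registers -/
  | cmul (d a b : ℕ)
  /-- `d := a / b` on scalar registers; the machine crashes if `b` holds `0` -/
  | cdiv (d a b : ℕ)
  /-- scalar register `d` gets the scalar memory cell whose address is in index register `a` -/
  | cload (d a : ℕ)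
  /-- the scalar memory cell whose address is in index register `a` gets scalar register `b` -/
  | cstore (a b : ℕ)
  /-- continue at line `l` if index register `a` holds less than index register `b` -/
  | jlt (a b l : ℕ)
  /-- continue at line `l` -/
  | jump (l : ℕ)

/-- A program is a finite list of instructions, with lines numbered from `0`. -/
abbrev Program := List Instr

structure Config where
  /-- the line to be executed next -/
  pc : ℕ
  ireg : ℕ → ℕ
  imem : ℕ → ℕ
  creg : ℕ → ℂ
  cmem : ℕ → ℂ

open Classical in
/-- The effect of one instruction; `none` is a crash. -/
noncomputable def Instr.exec (c : Config) : Instr → Option Config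
  | .iconst d k => some { c with pc := c.pc + 1, ireg := Function.update c.ireg d k }
  | .iadd d a b =>
      some { c with pc := c.pc + 1, ireg := Function.update c.ireg d (c.ireg a + c.ireg b) }
  | .isub d a b =>
      some { c with pc := c.pc + 1, ireg := Function.update c.ireg d (c.ireg a - c.ireg b) }
  | .iload d a =>
      some { c with pc := c.pc + 1, ireg := Function.update c.ireg d (c.imem (c.ireg a)) }
  | .istore a b =>
      some { c with pc := c.pc + 1, imem := Function.update c.imem (c.ireg a) (c.ireg b) }
  | .cconst d k => some { c with pc := c.pc + 1, creg := Function.update c.creg d (k : ℂ) }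
  | .cadd d a b =>
      some { c with pc := c.pc + 1, creg := Function.update c.creg d (c.creg a + c.creg b) }
  | .csub d a b =>
      some { c with pc := c.pc + 1, creg := Function.update c.creg d (c.creg a - c.creg b) }
  | .cmul d a b =>
      some { c with pc := c.pc + 1, creg := Function.update c.creg d (c.creg a * c.creg b) }
  | .cdiv d a b =>
      if c.creg b = 0 then none
      else some { c with pc := c.pc + 1, creg := Function.update c.creg d (c.creg a / c.creg b) }
  | .cload d a =>
      some { c with pc := c.pc + 1, creg := Function.update c.creg d (c.cmem (c.ireg a)) }
  | .cstore a b =>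
      some { c with pc := c.pc + 1, cmem := Function.update c.cmem (c.ireg a) (c.creg b) }
  | .jlt a b l => some { c with pc := if c.ireg a < c.ireg b then l else c.pc + 1 }
  | .jump l => some { c with pc := l }

/-- Execution of exactly `t` instructions of `P`; `none` if the machine crashes or runs past the
end of the program before that. -/
noncomputable def run (P : Program) : ℕ → Config → Option Config
  | 0, c => some c
  | t + 1, c => P[c.pc]?.bind fun I => (I.exec c).bind (run P t)

/-- Started in `c`, the program halts (by leaving the program text) after exactly `t` executed
instructions, with `v` in scalar register `0`. -/
def HaltsWith (P : Program) (c : Config) (t : ℕ) (v : ℂ) : Prop :=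
  ∃ c', run P t c = some c' ∧ P.length ≤ c'.pc ∧ c'.creg 0 = v

/-- The input `(n, w, s, A)`: `n` and `w` are in index registers `0` and `1`, the entries of `s` are
in cells `0, …, n - 1` of the index memory, and `A` is in row-major order in cells
`0, …, n * n - 1` of the scalar memory. Everything else is `0`. -/
def inputConfig (n w : ℕ) (s : Fin n → ℕ) (A : Matrix (Fin n) (Fin n) ℂ) : Config where
  pc := 0
  ireg := fun a => if a = 0 then n else if a = 1 then w else 0
  imem := fun a => if h : a < n then s ⟨a, h⟩ else 0
  creg := fun _ => 0
  cmem := fun a => if h : a < n * n then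
    A (Fin.divNat (⟨a, h⟩ : Fin (n * n))) (Fin.modNat (⟨a, h⟩ : Fin (n * n))) else 0

end LoopHaf

/-! Expand the loop hafnian along the row of one copy of the first remaining vertex `i`. By
bandedness that copy is matched with a copy of one of `i, …, i + w`, so once all copies of the
vertices before `i` are gone, only the multiplicities of these `w + 1` vertices can differ from the
original ones. Such states are the numbers with `w + 1` digits in base `c + 1`, and the expansion
gives the loop hafnian of each from `w + 1` earlier ones: a state with no copy of `i` is a state of
`i + 1`, and every other one has a larger code than the states it is matched down to. The
coefficients of the expansion are multiplicities, which the machine cannot convert to complex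
numbers; it adds repeatedly instead, at most `c` times per term, for about
`n (c + 1) ^ (w + 1) (w c + 1)` steps in total.

The program is written in a small structured language, for whose compilation to the random access
machine the number of executed steps is an explicit function of the initial state. -/

namespace LoopHaf

section Subsets

variable {V : Type*} [Fintype V] [DecidableEq V]

/-- The perfect matchings, with loops allowed, of the vertices in `S`. -/
def matchingsOn (S : Finset V) : Finset (Finset (Sym2 V)) :=
  Finset.univ.filter fun π =>
    ∀ v : V, (π.filter fun e => v ∈ e).card = if v ∈ S then 1 else 0

/-- The loop hafnian of the principal submatrix of `A` on `S`. -/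
def lhafOn (A : Matrix V V ℂ) (hA : A.IsSymm) (S : Finset V) : ℂ :=
  ∑ π ∈ matchingsOn S, ∏ e ∈ π, edgeWeight A hA e

theorem mem_matchingsOn {S : Finset V} {π : Finset (Sym2 V)} :
    π ∈ matchingsOn S ↔
      ∀ v : V, (π.filter fun e => v ∈ e).card = if v ∈ S then 1 else 0 := by
  simp [matchingsOn]

theorem lhafOn_univ (A : Matrix V V ℂ) (hA : A.IsSymm) :
    lhafOn A hA Finset.univ = lhaf A hA := by
  simp [lhafOn, lhaf, matchingsOn, perfectMatchings]

theorem lhafOn_empty (A : Matrix V V ℂ) (hA : A.IsSymm) : lhafOn A hA ∅ = 1 := by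
  have h : matchingsOn (∅ : Finset V) = {∅} := by
    ext π
    rw [mem_matchingsOn, Finset.mem_singleton]
    constructor
    · intro h
      rw [Finset.eq_empty_iff_forall_notMem]
      intro e he
      induction e with
      | _ a b =>
        have := h a
        rw [if_neg (Finset.notMem_empty a), Finset.card_eq_zero] at this
        exact Finset.eq_empty_iff_forall_notMem.1 this s(a, b) (by simp [he])
    · rintro rfl
      simp
  simp [lhafOn, h]

theorem notMem_of_mem_matchingsOn {S : Finset V} {π : Finset (Sym2 V)} (hπ : π ∈ matchingsOn S)
    {v : V} (hv : v ∉ S) {e : Sym2 V} (he : v ∈ e) : e ∉ π := by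
  intro h
  have := mem_matchingsOn.1 hπ v
  rw [if_neg hv, Finset.card_eq_zero] at this
  exact Finset.eq_empty_iff_forall_notMem.1 this e (by simp [h, he])

theorem insert_mem_matchingsOn_iff {S : Finset V} {v u : V} (hv : v ∈ S) (hu : u ∈ S)
    {π : Finset (Sym2 V)} (h : s(v, u) ∉ π) :
    insert s(v, u) π ∈ matchingsOn S ↔ π ∈ matchingsOn ((S.erase v).erase u) := by
  rw [mem_matchingsOn, mem_matchingsOn]
  refine forall_congr' fun x => ?_
  rw [Finset.filter_insert]
  by_cases hx : x ∈ s(v, u)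
  · have h' : s(v, u) ∉ π.filter fun e => x ∈ e := by simp [h]
    have hxS : x ∈ S := by
      rcases Sym2.mem_iff.1 hx with rfl | rfl <;> assumption
    have hx' : x ∉ (S.erase v).erase u := by
      rcases Sym2.mem_iff.1 hx with rfl | rfl <;> simp
    rw [if_pos hx, Finset.card_insert_of_notMem h', if_pos hxS, if_neg hx']
    simp
  · rw [if_neg hx]
    have : x ∈ (S.erase v).erase u ↔ x ∈ S := by
      rw [Sym2.mem_iff, not_or] at hx
      simp [hx.1, hx.2]
    simp only [this]

theorem exists_insert_eq_of_mem_matchingsOn {S : Finset V} {v : V} (hv : v ∈ S)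
    {π : Finset (Sym2 V)} (hπ : π ∈ matchingsOn S) :
    ∃ u ∈ S, ∃ π' ∈ matchingsOn ((S.erase v).erase u), insert s(v, u) π' = π := by
  have hcard := mem_matchingsOn.1 hπ v
  rw [if_pos hv, Finset.card_eq_one] at hcard
  obtain ⟨e, he⟩ := hcard
  have hfilter : e ∈ π.filter fun e => v ∈ e := by simp [he]
  obtain ⟨hmem, u, rfl⟩ := Finset.mem_filter.1 hfilter
  have hu : u ∈ S := by
    by_contra hu
    exact notMem_of_mem_matchingsOn hπ hu (by simp) hmem
  have hinsert : insert s(v, u) (π.erase s(v, u)) = π := Finset.insert_erase hmem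
  refine ⟨u, hu, π.erase s(v, u), ?_, hinsert⟩
  rwa [← insert_mem_matchingsOn_iff hv hu (Finset.notMem_erase _ _), hinsert]

theorem lhafOn_eq_sum (A : Matrix V V ℂ) (hA : A.IsSymm) {S : Finset V} {v : V} (hv : v ∈ S) :
    lhafOn A hA S = ∑ u ∈ S, A v u * lhafOn A hA ((S.erase v).erase u) := by
  have hnot : ∀ u : V, ∀ π ∈ matchingsOn ((S.erase v).erase u), ∀ u', s(v, u') ∉ π :=
    fun u π hπ u' => notMem_of_mem_matchingsOn hπ (v := v) (by simp) (by simp)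
  simp only [lhafOn, Finset.mul_sum]
  rw [Finset.sum_sigma']
  symm
  refine Finset.sum_bij (fun p _ => insert s(v, p.1) p.2) ?maps ?injective ?surjective ?term
  case maps =>
    rintro ⟨u, π⟩ h
    rw [Finset.mem_sigma] at h
    exact (insert_mem_matchingsOn_iff hv h.1 (hnot u π h.2 u)).2 h.2
  case injective =>
    rintro ⟨u, π⟩ h ⟨u', π'⟩ h' heq
    rw [Finset.mem_sigma] at h h'
    dsimp only at h h' heq
    have hmem : s(v, u) ∈ insert s(v, u') π' := heq ▸ Finset.mem_insert_self _ _
    obtain rfl : u = u' :=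
      Sym2.congr_right.1 ((Finset.mem_insert.1 hmem).resolve_right (hnot u' π' h'.2 u))
    rw [← Finset.erase_insert (hnot u π h.2 u), heq, Finset.erase_insert (hnot u π' h'.2 u)]
  case surjective =>
    intro π hπ
    obtain ⟨u, hu, π', hπ', heq⟩ := exists_insert_eq_of_mem_matchingsOn hv hπ
    exact ⟨⟨u, π'⟩, Finset.mem_sigma.2 ⟨hu, hπ'⟩, heq⟩
  case term =>
    rintro ⟨u, π⟩ h
    rw [Finset.mem_sigma] at h
    dsimp only
    rw [Finset.prod_insert (hnot u π h.2 u)]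
    rfl

section Map

variable {W : Type*} (f : W ↪ V)

theorem map_mem_matchingsOn_iff [Fintype W] [DecidableEq W] {S : Finset W} {π : Finset (Sym2 W)} :
    π.map f.sym2Map ∈ matchingsOn (S.map f) ↔ π ∈ matchingsOn S := by
  have hrange : ∀ v ∉ Set.range f, ((π.map f.sym2Map).filter fun e => v ∈ e) = ∅ := by
    refine fun v hv => Finset.filter_eq_empty_iff.2 fun e he hve => hv ?_
    obtain ⟨e, -, rfl⟩ := Finset.mem_map.1 he
    obtain ⟨w, -, rfl⟩ := Sym2.mem_map.1 hve
    exact ⟨w, rfl⟩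
  have hcard : ∀ w, ((π.map f.sym2Map).filter fun e => f w ∈ e).card =
      (π.filter fun e => w ∈ e).card := by
    intro w
    rw [Finset.filter_map, Finset.card_map]
    congr! 2
    simp [Sym2.mem_map]
  simp only [mem_matchingsOn]
  refine ⟨fun h w => by simpa [hcard] using h (f w), fun h v => ?_⟩
  by_cases hv : v ∈ Set.range f
  · obtain ⟨w, rfl⟩ := hv
    simpa [hcard] using h w
  · rw [hrange v hv, if_neg fun h => hv ?_, Finset.card_empty]
    obtain ⟨w, -, rfl⟩ := Finset.mem_map.1 h
    exact ⟨w, rfl⟩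

theorem exists_map_eq_of_mem_matchingsOn {S : Finset W} {π : Finset (Sym2 V)}
    (hπ : π ∈ matchingsOn (S.map f)) : ∃ π' : Finset (Sym2 W), π'.map f.sym2Map = π := by
  have hsub : π ⊆ S.sym2.map f.sym2Map := by
    intro e he
    induction e with
    | _ a b =>
      have hmem : ∀ v ∈ s(a, b), v ∈ S.map f := fun v hv => by
        by_contra hvS
        exact notMem_of_mem_matchingsOn hπ hvS hv he
      obtain ⟨a, ha, rfl⟩ := Finset.mem_map.1 (hmem a (by simp))
      obtain ⟨b, hb, rfl⟩ := Finset.mem_map.1 (hmem b (by simp))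
      exact Finset.mem_map.2 ⟨s(a, b), Finset.mk_mem_sym2_iff.2 ⟨ha, hb⟩, rfl⟩
  obtain ⟨π', -, rfl⟩ := Finset.subset_map_iff.1 hsub
  exact ⟨π', rfl⟩

theorem lhafOn_map [Fintype W] [DecidableEq W] (A : Matrix V V ℂ) (hA : A.IsSymm) (S : Finset W) :
    lhafOn A hA (S.map f) = lhafOn (A.submatrix f f) (hA.submatrix f) S := by
  have himage : matchingsOn (S.map f) =
      (matchingsOn S).map (Finset.mapEmbedding f.sym2Map).toEmbedding := by
    ext π
    constructor
    · intro hπ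
      obtain ⟨π', rfl⟩ := exists_map_eq_of_mem_matchingsOn f hπ
      exact Finset.mem_map.2 ⟨π', (map_mem_matchingsOn_iff f).1 hπ, rfl⟩
    · intro hπ
      obtain ⟨π', hπ', rfl⟩ := Finset.mem_map.1 hπ
      exact (map_mem_matchingsOn_iff f).2 hπ'
  rw [lhafOn, himage, Finset.sum_map]
  refine Finset.sum_congr rfl fun π _ => (Finset.prod_map ..).trans ?_
  refine Finset.prod_congr rfl fun e _ => ?_
  induction e with
  | _ a b => rfl

end Map

end Subsets

section Repeated

variable {n : ℕ} (A : Matrix (Fin n) (Fin n) ℂ) (hA : A.IsSymm)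

/-- The loop hafnian of `A` with its `i`-th row and column repeated `m i` times. The multiplicities
are indexed by `ℕ` to spare bound checks; only the first `n` of them count. -/
def repeatedLhaf (m : ℕ → ℕ) : ℂ :=
  lhaf (repeated A fun i => m i) (repeated_isSymm hA _)

theorem repeatedLhaf_zero : repeatedLhaf A hA 0 = 1 := by
  rw [repeatedLhaf, ← lhafOn_univ, ← lhafOn_empty (repeated A 0) (repeated_isSymm hA 0)]
  congr 1
  exact Finset.univ_eq_empty_iff.2 ⟨fun x => x.2.elim0⟩

/-- The vertices with the same image under `g` are copies of one another. -/
theorem lhafOn_submatrix {V : Type*} [Fintype V] [DecidableEq V] (g : V → Fin n)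
    (S : Finset V) :
    lhafOn (A.submatrix g g) (hA.submatrix g) S =
      repeatedLhaf A hA fun i => (S.filter fun v => g v = i).card := by
  let f : (Σ i : Fin n, Fin (S.filter fun v => (g v : ℕ) = i).card) ↪ V :=
    { toFun := fun x => ((S.filter fun v => (g v : ℕ) = x.1).equivFin.symm x.2 : V)
      inj' := by
        rintro ⟨i, x⟩ ⟨j, y⟩ h
        have hi := (Finset.mem_filter.1 ((S.filter fun v => (g v : ℕ) = i).equivFin.symm x).2).2
        have hj := (Finset.mem_filter.1 ((S.filter fun v => (g v : ℕ) = j).equivFin.symm y).2).2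
        obtain rfl : i = j := Fin.ext (by rw [← hi, ← hj]; exact congrArg (fun v => (g v : ℕ)) h)
        simpa [Subtype.ext_iff] using h }
  have hf : ∀ x, f x ∈ S.filter fun v => (g v : ℕ) = x.1 := fun x =>
    ((S.filter fun v => (g v : ℕ) = x.1).equivFin.symm x.2).2
  have hg : ∀ x, g (f x) = x.1 := fun x => Fin.ext (Finset.mem_filter.1 (hf x)).2
  have hS : Finset.univ.map f = S := by
    ext v
    simp only [Finset.mem_map, Finset.mem_univ, true_and]
    constructor
    · rintro ⟨x, rfl⟩
      exact (Finset.mem_filter.1 (hf x)).1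
    · intro hv
      refine ⟨⟨g v, (S.filter fun u => (g u : ℕ) = g v).equivFin ⟨v, by simp [hv]⟩⟩, ?_⟩
      change ((Finset.equivFin _).symm (Finset.equivFin _ _)).1 = v
      rw [Equiv.symm_apply_apply]
  conv_lhs => rw [← hS, lhafOn_map, lhafOn_univ]
  rw [repeatedLhaf]
  congr 1
  ext x y
  simp [repeated, hg]

theorem card_filter_erase {V : Type*} [DecidableEq V] (g : V → ℕ) {S : Finset V} {v : V}
    (hv : v ∈ S) :
    (fun i => ((S.erase v).filter fun u => g u = i).card) =
      (fun i => (S.filter fun u => g u = i).card) - Pi.single (g v) 1 := by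
  ext i
  rw [Pi.sub_apply, Finset.filter_erase]
  by_cases hi : g v = i
  · subst hi
    rw [Finset.card_erase_of_mem (by simp [hv]), Pi.single_eq_same]
  · rw [Finset.erase_eq_of_notMem (by simp [hi]), Pi.single_eq_of_ne (Ne.symm hi), Nat.sub_zero]

theorem card_filter_sigma {m : ℕ → ℕ} (hm : ∀ v ≥ n, m v = 0) (j : ℕ) :
    (Finset.univ.filter fun u : Σ i : Fin n, Fin (m i) => (u.1 : ℕ) = j).card = m j := by
  rcases lt_or_ge j n with hj | hj
  · have hfiber : (Finset.univ.filter fun u : Σ i : Fin n, Fin (m i) => (u.1 : ℕ) = j) =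
        Finset.univ.map (Function.Embedding.sigmaMk (⟨j, hj⟩ : Fin n)) := by
      ext ⟨k, x⟩
      simp only [Finset.mem_filter, Finset.mem_univ, true_and, Finset.mem_map]
      exact ⟨by rintro rfl; exact ⟨x, rfl⟩,
        by rintro ⟨y, hy⟩; exact (congrArg (fun u => (u.1 : ℕ)) hy).symm⟩
    rw [hfiber, Finset.card_map, Finset.card_fin]
  · rw [hm j hj, Finset.card_eq_zero, Finset.filter_eq_empty_iff]
    rintro ⟨k, x⟩ -
    exact (k.2.trans_le hj).ne

theorem repeatedLhaf_eq_add_sum {m : ℕ → ℕ} {i : Fin n} (hi : m i ≠ 0)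
    (hm : ∀ v ≥ n, m v = 0) :
    repeatedLhaf A hA m = A i i * repeatedLhaf A hA (m - Pi.single (i : ℕ) 1) +
      ∑ j : Fin n, ((m - Pi.single (i : ℕ) 1 : ℕ → ℕ) j : ℂ) * (A i j *
        repeatedLhaf A hA (m - Pi.single (i : ℕ) 1 - Pi.single (j : ℕ) 1)) := by
  let v : Σ i : Fin n, Fin (m i) := ⟨i, 0, Nat.pos_of_ne_zero hi⟩
  have hcard : (fun j : ℕ => ((Finset.univ.erase v).filter fun u => (u.1 : ℕ) = j).card) =
      m - Pi.single (i : ℕ) 1 := by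
    rw [card_filter_erase (fun u => (u.1 : ℕ)) (Finset.mem_univ v),
      funext (card_filter_sigma hm)]
  have hterm : ∀ u ∈ Finset.univ.erase v,
      lhafOn (A.submatrix Sigma.fst Sigma.fst) (hA.submatrix _) ((Finset.univ.erase v).erase u) =
        repeatedLhaf A hA (m - Pi.single (i : ℕ) 1 - Pi.single (u.1 : ℕ) 1) := fun u hu => by
    rw [lhafOn_submatrix A hA, card_filter_erase (fun u => (u.1 : ℕ)) hu, hcard]
  calc repeatedLhaf A hA m
      = ∑ u, A i u.1 * lhafOn (A.submatrix Sigma.fst Sigma.fst) (hA.submatrix _)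
          ((Finset.univ.erase v).erase u) := by
        rw [repeatedLhaf, ← lhafOn_univ]
        exact lhafOn_eq_sum _ _ (Finset.mem_univ v)
    _ = A i i * repeatedLhaf A hA (m - Pi.single (i : ℕ) 1) +
          ∑ u ∈ Finset.univ.erase v,
            A i u.1 * repeatedLhaf A hA (m - Pi.single (i : ℕ) 1 - Pi.single (u.1 : ℕ) 1) := by
        rw [← Finset.add_sum_erase _ _ (Finset.mem_univ v), Finset.erase_idem,
          lhafOn_submatrix A hA, hcard]
        exact congrArg _ (Finset.sum_congr rfl fun u hu => by rw [hterm u hu])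
    _ = _ := by
        rw [← Finset.sum_fiberwise _ Sigma.fst]
        refine congrArg _ (Finset.sum_congr rfl fun j _ => ?_)
        rw [← congrFun hcard j, ← nsmul_eq_mul, ← Finset.sum_const]
        simp only [Fin.val_inj]
        refine Finset.sum_congr rfl fun u hu => ?_
        rw [(Finset.mem_filter.1 hu).2]

theorem sum_range_eq_sum_window {f : ℕ → ℂ} {i w n : ℕ}
    (hf : ∀ v, v < i ∨ i + w < v ∨ n ≤ v → f v = 0) :
    ∑ v ∈ Finset.range n, f v = f i + ∑ e ∈ Finset.range w, f (i + e + 1) := by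
  have htrunc : ∑ v ∈ Finset.Ico i (i + (w + 1)), f v = ∑ v ∈ Finset.range n, f v := by
    refine Finset.sum_congr_of_eq_on_inter ?_ ?_ fun _ _ _ => rfl
    all_goals
      intro v hv hv'
      simp only [Finset.mem_Ico, Finset.mem_range] at hv hv'
      exact hf v (by omega)
  rw [← htrunc, Finset.sum_Ico_eq_sum_range, Nat.add_sub_cancel_left, Finset.sum_range_succ',
    add_comm]
  rfl

variable {A} in
theorem repeatedLhaf_of_isBanded {w : ℕ} (hband : IsBanded A w) {m : ℕ → ℕ} {i : ℕ}
    (hin : i < n) {a : ℕ → ℂ}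
    (ha : ∀ j : Fin n, a j = A ⟨i, hin⟩ j) (hi : m i ≠ 0)
    (hlt : ∀ v < i, m v = 0) (hge : ∀ v ≥ n, m v = 0) :
    repeatedLhaf A hA m =
      a i * (repeatedLhaf A hA (m - Pi.single i 1) +
        ((m i - 1 : ℕ) : ℂ) * repeatedLhaf A hA (m - Pi.single i 1 - Pi.single i 1)) +
      ∑ e ∈ Finset.range w, (m (i + e + 1) : ℂ) * (a (i + e + 1) *
        repeatedLhaf A hA (m - Pi.single i 1 - Pi.single (i + e + 1) 1)) := by
  have hzero : ∀ v, v < i ∨ i + w < v ∨ n ≤ v →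
      ((m - Pi.single i 1 : ℕ → ℕ) v : ℂ) * (a v *
        repeatedLhaf A hA (m - Pi.single i 1 - Pi.single v 1)) = 0 := by
    intro v hv
    by_cases hvn : v < n
    · rcases hv with hv | hv | hv
      · simp [hlt v hv]
      · rw [ha ⟨v, hvn⟩, hband, zero_mul, mul_zero]
        exact lt_abs.2 (Or.inr (by simp only; omega))
      · omega
    · simp [hge v (not_lt.1 hvn)]
  have hsum := Fin.sum_univ_eq_sum_range (fun v => ((m - Pi.single i 1 : ℕ → ℕ) v : ℂ) * (a v *
        repeatedLhaf A hA (m - Pi.single i 1 - Pi.single v 1))) n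
  rw [repeatedLhaf_eq_add_sum A hA (i := ⟨i, hin⟩) hi hge]
  simp only [← ha]
  rw [hsum, sum_range_eq_sum_window hzero, ← add_assoc, mul_add]
  congr 1
  · rw [Pi.sub_apply, Pi.single_eq_same]
    ring
  · refine Finset.sum_congr rfl fun e _ => ?_
    rw [Pi.sub_apply, Pi.single_eq_of_ne (by omega), Nat.sub_zero]

end Repeated

section Window

/-- The multiplicities `m i, …, m (i + k - 1)`, read as the digits of a number in base `b`. This
is the place of `lhaf(A_m)` in the table of vertex `i`. -/
def windowCode (b i k : ℕ) (m : ℕ → ℕ) : ℕ :=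
  ∑ e ∈ Finset.range k, m (i + e) * b ^ e

variable {b i k : ℕ} {m : ℕ → ℕ}

theorem windowCode_succ_left :
    windowCode b i (k + 1) m = m i + b * windowCode b (i + 1) k m := by
  rw [windowCode, windowCode, Finset.sum_range_succ', Finset.mul_sum, add_comm]
  congr 1
  · rw [pow_zero, mul_one, add_zero]
  · refine Finset.sum_congr rfl fun e _ => ?_
    rw [← add_assoc, add_right_comm, pow_succ']
    ring

theorem windowCode_succ_right :
    windowCode b i (k + 1) m = windowCode b i k m + m (i + k) * b ^ k :=
  Finset.sum_range_succ ..

theorem windowCode_lt (hm : ∀ v, m v < b) : windowCode b i k m < b ^ k := by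
  induction k with
  | zero => simp [windowCode]
  | succ k ih =>
    have : (m (i + k) + 1) * b ^ k ≤ b * b ^ k := Nat.mul_le_mul_right _ (hm _)
    rw [windowCode_succ_right, pow_succ']
    linarith

theorem digit_windowCode (hm : ∀ v, m v < b) {e : ℕ} (he : e < k) :
    windowCode b i k m / b ^ e % b = m (i + e) := by
  obtain ⟨k, rfl⟩ := Nat.exists_eq_add_of_lt he
  have hb : 0 < b := (Nat.zero_le _).trans_lt (hm 0)
  induction e generalizing i with
  | zero =>
    rw [pow_zero, Nat.div_one, windowCode_succ_left, Nat.add_mul_mod_self_left,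
      Nat.mod_eq_of_lt (hm i), add_zero]
  | succ e ih =>
    rw [windowCode_succ_left, pow_succ', ← Nat.div_div_eq_div_mul, Nat.add_mul_div_left _ _ hb,
      Nat.div_eq_of_lt (hm i), zero_add, Nat.add_right_comm e 1 k, ih (by omega), add_assoc,
      add_comm 1 e]

theorem eq_and_windowCode_eq (hm : ∀ v, m v < b) {y r : ℕ} (hr : r < b)
    (hcode : windowCode b i (k + 1) m = b * y + r) : m i = r ∧ windowCode b (i + 1) k m = y := by
  have hb : 0 < b := (Nat.zero_le _).trans_lt hr
  rw [windowCode_succ_left] at hcode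
  have hmi : m i = r := by
    simpa only [Nat.add_mul_mod_self_left, Nat.mul_add_mod, Nat.mod_eq_of_lt (hm i),
      Nat.mod_eq_of_lt hr] using congrArg (· % b) hcode
  exact ⟨hmi, Nat.eq_of_mul_eq_mul_left hb (by omega)⟩

theorem windowCode_sub_single {f : ℕ} (hf : f < k) (hm : m (i + f) ≠ 0) :
    windowCode b i k (m - Pi.single (i + f) 1) + b ^ f = windowCode b i k m := by
  have hsplit : ∀ e ∈ Finset.range k,
      m (i + e) * b ^ e =
        (m - Pi.single (i + f) 1 : ℕ → ℕ) (i + e) * b ^ e + if f = e then b ^ e else 0 := by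
    intro e _
    rcases eq_or_ne f e with rfl | hfe
    · rw [Pi.sub_apply, Pi.single_eq_same, if_pos rfl, ← Nat.succ_mul,
        Nat.succ_eq_add_one, Nat.sub_add_cancel (Nat.one_le_iff_ne_zero.2 hm)]
    · rw [Pi.sub_apply, Pi.single_eq_of_ne (by omega), Nat.sub_zero, if_neg hfe, add_zero]
  rw [windowCode, windowCode, Finset.sum_congr rfl hsplit, Finset.sum_add_distrib,
    Finset.sum_ite_eq, if_pos (Finset.mem_range.2 hf)]

/-- The multiplicities that occur when the vertices before `i` have been matched: those after
`i + w` have not been touched yet, as `i - 1` has no neighbour beyond. -/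
structure InWindow (S : ℕ → ℕ) (w i : ℕ) (m : ℕ → ℕ) : Prop where
  le : m ≤ S
  eq_zero : ∀ v < i, m v = 0
  eq_of_lt : ∀ v, i + w < v → m v = S v

theorem InWindow.sub_single {S : ℕ → ℕ} {w f : ℕ} (h : InWindow S w i m) (hf : f ≤ w) :
    InWindow S w i (m - Pi.single (i + f) 1) where
  le := tsub_le_self.trans h.le
  eq_zero v hv := by rw [Pi.sub_apply, h.eq_zero v hv, Nat.zero_sub]
  eq_of_lt v hv := by
    rw [Pi.sub_apply, Pi.single_eq_of_ne (by omega), Nat.sub_zero, h.eq_of_lt v hv]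

end Window

section Table

variable {n : ℕ} (A : Matrix (Fin n) (Fin n) ℂ) (hA : A.IsSymm) (S : ℕ → ℕ) (w b : ℕ)

/-- The memory `M` contains, from address `q` on, the first `N` entries of the table of vertex `i`:
entry number `windowCode b i (w + 1) m` is `lhaf(A_m)`, for `m` in the window. -/
def IsTable (i N : ℕ) (M : ℕ → ℂ) (q : ℕ) : Prop :=
  ∀ m, InWindow S w i m → windowCode b i (w + 1) m < N →
    M (q + windowCode b i (w + 1) m) = repeatedLhaf A hA m

variable {A hA S w b} {i N q : ℕ} {M : ℕ → ℂ}

theorem isTable_zero : IsTable A hA S w b i 0 M q := fun _ _ h => absurd h (Nat.not_lt_zero _)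

theorem IsTable.succ (h : IsTable A hA S w b i N M q)
    (hN : ∀ m, InWindow S w i m → windowCode b i (w + 1) m = N →
      M (q + N) = repeatedLhaf A hA m) :
    IsTable A hA S w b i (N + 1) M q := by
  intro m hm hlt
  rcases Nat.lt_succ_iff_lt_or_eq.1 hlt with hlt | heq
  · exact h m hm hlt
  · rw [heq, hN m hm heq]

theorem IsTable.congr {M' : ℕ → ℂ} (h : IsTable A hA S w b i N M q)
    (hM : ∀ a < q + N, M' a = M a) : IsTable A hA S w b i N M' q := fun m hm hlt => by
  rw [hM _ (by omega), h m hm hlt]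

theorem isTable_last (hS : ∀ v ≥ n, S v = 0) (hM : M q = 1) : IsTable A hA S w b n N M q := by
  intro m hm _
  obtain rfl : m = 0 := by
    ext v
    rcases lt_or_ge v n with hv | hv
    · exact hm.eq_zero v hv
    · exact Nat.eq_zero_of_le_zero ((hm.le v).trans_eq (hS v hv))
  simp only [windowCode, Pi.zero_apply, zero_mul, Finset.sum_const_zero, add_zero, hM,
    repeatedLhaf_zero]

theorem IsTable.repeatedLhaf_sub_single (h : IsTable A hA S w b i N M q) (hb : 0 < b)
    {m : ℕ → ℕ} (hm : InWindow S w i m) {f : ℕ} (hf : f ≤ w) (hmf : m (i + f) ≠ 0)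
    (hcode : windowCode b i (w + 1) m ≤ N) :
    repeatedLhaf A hA (m - Pi.single (i + f) 1) = M (q + windowCode b i (w + 1) m - b ^ f) := by
  have hsub : windowCode b i (w + 1) (m - Pi.single (i + f) 1) + b ^ f = _ :=
    windowCode_sub_single (Nat.lt_succ_of_le hf) hmf
  have hpow := Nat.pow_pos (n := f) hb
  rw [← h _ (hm.sub_single hf) (by omega), ← hsub, ← add_assoc, Nat.add_sub_cancel]

variable {m : ℕ → ℕ} {y : ℕ}

theorem IsTable.repeatedLhaf_eq_of_zero (hSb : ∀ v, S v < b) (hm : InWindow S w i m)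
    (h : IsTable A hA S w b (i + 1) (b ^ (w + 1)) M q)
    (hcode : windowCode b i (w + 1) m = b * y) :
    repeatedLhaf A hA m = M (q + (y + S (i + w + 1) * b ^ w)) := by
  have hmb : ∀ v, m v < b := fun v => (hm.le v).trans_lt (hSb v)
  have hb : 0 < b := (Nat.zero_le _).trans_lt (hSb 0)
  obtain ⟨hmi, hy⟩ := eq_and_windowCode_eq hmb hb hcode
  have hm' : InWindow S w (i + 1) m :=
    { le := hm.le
      eq_zero := fun v hv => (Nat.lt_succ_iff_lt_or_eq.1 hv).elim (hm.eq_zero v) (· ▸ hmi)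
      eq_of_lt := fun v hv => hm.eq_of_lt v (by omega) }
  rw [← h m hm' (windowCode_lt hmb), windowCode_succ_right, hy, add_right_comm i 1 w,
    hm.eq_of_lt _ (Nat.lt_succ_self _)]

theorem IsTable.repeatedLhaf_eq_of_succ (hSb : ∀ v, S v < b) (hm : InWindow S w i m)
    (hband : IsBanded A w) (hS : ∀ v ≥ n, S v = 0) (hin : i < n) {a : ℕ → ℂ}
    (ha : ∀ j : Fin n, a j = A ⟨i, hin⟩ j) {r : ℕ} (hr : r + 1 < b)
    (h : IsTable A hA S w b i (b * y + r + 1) M q)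
    (hcode : windowCode b i (w + 1) m = b * y + r + 1) :
    repeatedLhaf A hA m =
      a i * (M (q + (b * y + r)) + r * M (q + (b * y + r) - 1)) +
        ∑ e ∈ Finset.range w, ((y / b ^ e % b : ℕ) : ℂ) *
          (a (i + e + 1) * M (q + (b * y + r) - b ^ (e + 1))) := by
  have hmb : ∀ v, m v < b := fun v => (hm.le v).trans_lt (hSb v)
  have hb : 0 < b := (Nat.zero_le _).trans_lt (hSb 0)
  obtain ⟨hmi, hy⟩ := eq_and_windowCode_eq hmb hr hcode
  have hm₁ : InWindow S w i (m - Pi.single i 1) := hm.sub_single w.zero_le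
  have hcode₁ : windowCode b i (w + 1) (m - Pi.single i 1) + b ^ 0 = b * y + r + 1 :=
    hcode ▸ windowCode_sub_single (f := 0) w.succ_pos (hmi ▸ r.succ_ne_zero)
  replace hcode₁ : windowCode b i (w + 1) (m - Pi.single i 1) = b * y + r :=
    Nat.succ.inj hcode₁
  have hfirst : repeatedLhaf A hA (m - Pi.single i 1) = M (q + (b * y + r)) := by
    rw [← h _ hm₁ (by omega), hcode₁]
  have hnext : ∀ f ≤ w, (m - Pi.single i 1 : ℕ → ℕ) (i + f) ≠ 0 →
      repeatedLhaf A hA (m - Pi.single i 1 - Pi.single (i + f) 1) =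
        M (q + (b * y + r) - b ^ f) := fun f hf hmf => by
    rw [h.repeatedLhaf_sub_single hb hm₁ hf hmf (by omega), hcode₁]
  rw [repeatedLhaf_of_isBanded hA hband hin ha (hmi ▸ r.succ_ne_zero) hm.eq_zero
    fun v hv => Nat.eq_zero_of_le_zero ((hm.le v).trans_eq (hS v hv)), hmi, hfirst,
    Nat.add_sub_cancel]
  congr 1
  · congr 2
    rcases eq_or_ne r 0 with rfl | hr
    · simp only [zero_mul, Nat.cast_zero]
    · exact congrArg _ (hnext 0 w.zero_le (by simpa [hmi] using hr))
  · refine Finset.sum_congr rfl fun e he => ?_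
    have hew := Finset.mem_range.1 he
    have hdigit : y / b ^ e % b = m (i + e + 1) := by
      rw [← hy, digit_windowCode hmb hew, add_right_comm]
    rw [hdigit]
    rcases eq_or_ne (m (i + e + 1)) 0 with hme | hme
    · rw [hme, Nat.cast_zero, zero_mul, zero_mul]
    · rw [add_assoc i e 1] at hme ⊢
      rw [hnext (e + 1) hew]
      rwa [Pi.sub_apply, Pi.single_eq_of_ne (by omega), Nat.sub_zero]

end Table

section Language

variable {ι κ : Type*}

/-- The values of the variables of a structured program, together with the two memories; `ι` is the
type of the index variables and `κ` that of the scalar variables. -/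
@[ext]
structure State (ι κ : Type*) where
  ireg : ι → ℕ
  imem : ℕ → ℕ
  creg : κ → ℂ
  cmem : ℕ → ℂ

/-- Expressions with a natural number as value; `load a` is the index memory cell at address `a`. -/
inductive IExpr (ι : Type*) where
  | const (k : ℕ)
  | var (x : ι)
  | add (a b : IExpr ι)
  | sub (a b : IExpr ι)
  | load (a : IExpr ι)

/-- Expressions with a complex value; `load a` is the scalar memory cell at address `a`. -/
inductive CExpr (ι κ : Type*) where
  | const (k : ℕ)
  | var (x : κ)
  | add (a b : CExpr ι κ)
  | mul (a b : CExpr ι κ)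
  | load (a : IExpr ι)

instance : Coe ι (IExpr ι) := ⟨IExpr.var⟩
instance (k : ℕ) : OfNat (IExpr ι) k := ⟨IExpr.const k⟩
instance : Add (IExpr ι) := ⟨IExpr.add⟩
instance : Sub (IExpr ι) := ⟨IExpr.sub⟩

instance : Coe κ (CExpr ι κ) := ⟨CExpr.var⟩
instance (k : ℕ) : OfNat (CExpr ι κ) k := ⟨CExpr.const k⟩
instance : Add (CExpr ι κ) := ⟨CExpr.add⟩
instance : Mul (CExpr ι κ) := ⟨CExpr.mul⟩

/-- Structured programs: assignments to variables and to memory cells, composition, and the loop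
`loop e S`, which executes `S` as many times as the value of `e` before the first round. -/
inductive Stmt (ι κ : Type*) where
  | iset (x : ι) (e : IExpr ι)
  | cset (x : κ) (e : CExpr ι κ)
  | istore (a e : IExpr ι)
  | cstore (a : IExpr ι) (e : CExpr ι κ)
  | seq (S T : Stmt ι κ)
  | loop (e : IExpr ι) (S : Stmt ι κ)

/-- The value of an index expression in the state `σ`; subtraction is truncated. -/
def IExpr.eval (σ : State ι κ) : IExpr ι → ℕ
  | const k => k
  | var x => σ.ireg x
  | add a b => a.eval σ + b.eval σ
  | sub a b => a.eval σ - b.eval σ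
  | load a => σ.imem (a.eval σ)

/-- The value of a scalar expression in the state `σ`. -/
noncomputable def CExpr.eval (σ : State ι κ) : CExpr ι κ → ℂ
  | const k => k
  | var x => σ.creg x
  | add a b => a.eval σ + b.eval σ
  | mul a b => a.eval σ * b.eval σ
  | load a => σ.cmem (a.eval σ)

section Eval

variable (σ : State ι κ)

@[simp] theorem IExpr.eval_var (x : ι) : (IExpr.var x).eval σ = σ.ireg x := rfl
@[simp] theorem IExpr.eval_ofNat (k : ℕ) :
    (no_index (OfNat.ofNat k) : IExpr ι).eval σ = OfNat.ofNat k := rfl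
@[simp] theorem IExpr.eval_add (a b : IExpr ι) : (a + b).eval σ = a.eval σ + b.eval σ := rfl
@[simp] theorem IExpr.eval_sub (a b : IExpr ι) : (a - b).eval σ = a.eval σ - b.eval σ := rfl
@[simp] theorem IExpr.eval_load (a : IExpr ι) : a.load.eval σ = σ.imem (a.eval σ) := rfl

@[simp] theorem CExpr.eval_var (x : κ) : (CExpr.var x : CExpr ι κ).eval σ = σ.creg x := rfl
@[simp] theorem CExpr.eval_ofNat (k : ℕ) :
    (no_index (OfNat.ofNat k) : CExpr ι κ).eval σ = Nat.cast k := rfl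
@[simp] theorem CExpr.eval_add (a b : CExpr ι κ) : (a + b).eval σ = a.eval σ + b.eval σ := rfl
@[simp] theorem CExpr.eval_mul (a b : CExpr ι κ) : (a * b).eval σ = a.eval σ * b.eval σ := rfl
@[simp] theorem CExpr.eval_load (a : IExpr ι) :
    (CExpr.load a : CExpr ι κ).eval σ = σ.cmem (a.eval σ) := rfl

end Eval

/-- The number of instructions in the compiled expression. -/
def IExpr.size : IExpr ι → ℕ
  | const _ => 1
  | var _ => 2
  | add a b => a.size + b.size + 1
  | sub a b => a.size + b.size + 1
  | load a => a.size + 1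

/-- The number of instructions in the compiled expression. -/
def CExpr.size : CExpr ι κ → ℕ
  | const _ => 1
  | var _ => 2
  | add a b => a.size + b.size + 1
  | mul a b => a.size + b.size + 1
  | load a => a.size + 1

/-- Where the compiled program keeps the variables: each has its own register, with a number below
`bound`. -/
structure Layout (ι κ : Type*) where
  ireg : ι ↪ ℕ
  creg : κ ↪ ℕ
  bound : ℕ
  ireg_lt : ∀ x, ireg x < bound
  creg_lt : ∀ x, creg x < bound

variable (L : Layout ι κ)

/-- The state of the structured program that a configuration of the machine represents. -/
def Layout.view (c : Config) : State ι κ :=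
  ⟨c.ireg ∘ L.ireg, c.imem, c.creg ∘ L.creg, c.cmem⟩

/-- Code that leaves the value of the expression in index register `d` and uses only the index
registers from `d` on as scratch space. -/
def IExpr.compile (d : ℕ) : IExpr ι → Program
  | const k => [.iconst d k]
  | var x => [.iconst d 0, .iadd d (L.ireg x) d]
  | add a b => a.compile d ++ b.compile (d + 1) ++ [.iadd d d (d + 1)]
  | sub a b => a.compile d ++ b.compile (d + 1) ++ [.isub d d (d + 1)]
  | load a => a.compile d ++ [.iload d d]

/-- Code that leaves the value of the expression in scalar register `d` and uses only the registers
from `d` on as scratch space. -/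
def CExpr.compile (d : ℕ) : CExpr ι κ → Program
  | const k => [.cconst d k]
  | var x => [.cconst d 0, .cadd d (L.creg x) d]
  | add a b => a.compile d ++ b.compile (d + 1) ++ [.cadd d d (d + 1)]
  | mul a b => a.compile d ++ b.compile (d + 1) ++ [.cmul d d (d + 1)]
  | load a => a.compile L d ++ [.cload d d]

theorem IExpr.length_compile (d : ℕ) (e : IExpr ι) : (e.compile L d).length = e.size := by
  induction e generalizing d <;> simp_all [compile, size, add_assoc]

theorem CExpr.length_compile (d : ℕ) (e : CExpr ι κ) : (e.compile L d).length = e.size := by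
  induction e generalizing d <;> simp_all [compile, size, IExpr.length_compile, add_assoc]

/-- Code for line `l`, which executes `body` as many times as the value of index register `d` and
then continues at line `l'`. -/
def loopCode (d l l' : ℕ) (body : Program) : Program :=
  [.iconst (d + 1) 0, .jlt (d + 1) d (l + 3), .jump l', .iconst (d + 1) 1, .isub d d (d + 1)] ++
    body ++ [.jump l]

namespace Stmt

/-- The number of instructions in the compiled program. -/
def size : Stmt ι κ → ℕ
  | iset _ e => e.size + 2
  | cset _ e => e.size + 2
  | istore a e => a.size + e.size + 1
  | cstore a e => a.size + e.size + 1
  | seq S T => S.size + T.size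
  | loop e S => e.size + S.size + 6

/-- Code for line `l` of a program, using only the registers from `d` on as scratch space. A loop
counts down the remaining rounds in index register `d`. -/
def compile (d l : ℕ) : Stmt ι κ → Program
  | iset x e =>
      e.compile L d ++ (IExpr.const 0).compile L (d + 1) ++ [.iadd (L.ireg x) d (d + 1)]
  | cset x e =>
      e.compile L d ++ (CExpr.const 0).compile L (d + 1) ++ [.cadd (L.creg x) d (d + 1)]
  | istore a e => a.compile L d ++ e.compile L (d + 1) ++ [.istore d (d + 1)]
  | cstore a e => a.compile L d ++ e.compile L (d + 1) ++ [.cstore d (d + 1)]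
  | seq S T => S.compile d l ++ T.compile d (l + S.size)
  | loop e S =>
      e.compile L d ++
        loopCode d (l + e.size) (l + e.size + S.size + 6) (S.compile (d + 1) (l + e.size + 5))

theorem length_compile (d l : ℕ) (S : Stmt ι κ) : (S.compile L d l).length = S.size := by
  induction S generalizing d l <;>
    simp_all [compile, loopCode, size, IExpr.length_compile, CExpr.length_compile, IExpr.size,
      CExpr.size] <;> omega

variable [DecidableEq ι] [DecidableEq κ]

/-- The state after the execution of a structured program. -/
noncomputable def exec : Stmt ι κ → State ι κ → State ι κ
  | iset x e, σ => { σ with ireg := Function.update σ.ireg x (e.eval σ) }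
  | cset x e, σ => { σ with creg := Function.update σ.creg x (e.eval σ) }
  | istore a e, σ => { σ with imem := Function.update σ.imem (a.eval σ) (e.eval σ) }
  | cstore a e, σ => { σ with cmem := Function.update σ.cmem (a.eval σ) (e.eval σ) }
  | seq S T, σ => T.exec (S.exec σ)
  | loop e S, σ => S.exec^[e.eval σ] σ

/-- The number of steps that the compiled program takes. -/
noncomputable def time : Stmt ι κ → State ι κ → ℕ
  | iset _ e, _ => e.size + 2
  | cset _ e, _ => e.size + 2
  | istore a e, _ => a.size + e.size + 1
  | cstore a e, _ => a.size + e.size + 1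
  | seq S T, σ => S.time σ + T.time (S.exec σ)
  | loop e S, σ =>
      e.size + 3 + ∑ j ∈ Finset.range (e.eval σ), (S.time (S.exec^[j] σ) + 5)

end Stmt

section Compilation

/-- `P` contains the code `l` from line `pc` on. -/
def HasCode (P : Program) (pc : ℕ) (l : Program) : Prop :=
  ∀ k < l.length, P[pc + k]? = l[k]?

variable {P : Program} {pc : ℕ}

theorem hasCode_self (P : Program) : HasCode P 0 P := fun k _ => by rw [Nat.zero_add]

theorem hasCode_append {l l' : Program} :
    HasCode P pc (l ++ l') ↔ HasCode P pc l ∧ HasCode P (pc + l.length) l' := by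
  refine ⟨fun h => ⟨fun k hk => ?_, fun k hk => ?_⟩, fun h k hk => ?_⟩
  · rw [h k (by simp; omega), List.getElem?_append_left hk]
  · rw [add_assoc, h _ (by simpa using hk), List.getElem?_append_right (by omega),
      Nat.add_sub_cancel_left]
  · rcases lt_or_ge k l.length with hkl | hkl
    · rw [h.1 k hkl, List.getElem?_append_left hkl]
    · obtain ⟨k, rfl⟩ := Nat.exists_eq_add_of_le hkl
      rw [← add_assoc, h.2 k (by simpa using hk), List.getElem?_append_right (by omega),
        Nat.add_sub_cancel_left]

theorem hasCode_cons {I : Instr} {l : Program} :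
    HasCode P pc (I :: l) ↔ P[pc]? = some I ∧ HasCode P (pc + 1) l := by
  rw [← List.singleton_append, hasCode_append]
  simp [HasCode]

theorem run_add (P : Program) (t t' : ℕ) (c : Config) :
    run P (t + t') c = (run P t c).bind (run P t') := by
  induction t generalizing c with
  | zero => simp [run]
  | succ t ih =>
    rw [Nat.succ_add, run, run]
    cases P[c.pc]? with
    | none => rfl
    | some I => cases hI : I.exec c <;> simp [hI, ih]

theorem run_succ {t : ℕ} {c : Config} {I : Instr} (h : P[c.pc]? = some I) :
    run P (t + 1) c = (I.exec c).bind (run P t) := by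
  rw [run, h, Option.bind_some]

/-- `c'` is reached from `c` in `t` steps, which leave alone the memories and all registers below
`d`. -/
structure Computes (P : Program) (d t : ℕ) (c c' : Config) : Prop where
  run_eq : run P t c = some c'
  ireg_eq : ∀ r < d, c'.ireg r = c.ireg r
  imem_eq : c'.imem = c.imem
  creg_eq : ∀ r < d, c'.creg r = c.creg r
  cmem_eq : c'.cmem = c.cmem

namespace Computes

variable {d d' t t' : ℕ} {c c' c'' : Config}

theorem trans (h : Computes P d t c c') (h' : Computes P d t' c' c'') :
    Computes P d (t + t') c c'' where
  run_eq := by rw [run_add, h.run_eq, Option.bind_some, h'.run_eq]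
  ireg_eq r hr := (h'.ireg_eq r hr).trans (h.ireg_eq r hr)
  imem_eq := h'.imem_eq.trans h.imem_eq
  creg_eq r hr := (h'.creg_eq r hr).trans (h.creg_eq r hr)
  cmem_eq := h'.cmem_eq.trans h.cmem_eq

theorem mono (h : Computes P d t c c') (hd : d' ≤ d) : Computes P d' t c c' :=
  { h with
    ireg_eq := fun r hr => h.ireg_eq r (hr.trans_le hd)
    creg_eq := fun r hr => h.creg_eq r (hr.trans_le hd) }

theorem view_eq {L : Layout ι κ} (h : Computes P d t c c') (hd : L.bound ≤ d) :
    L.view c' = L.view c := by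
  ext x
  · exact h.ireg_eq _ ((L.ireg_lt x).trans_le hd)
  · rw [Layout.view, h.imem_eq, Layout.view]
  · exact h.creg_eq _ ((L.creg_lt x).trans_le hd)
  · rw [Layout.view, h.cmem_eq, Layout.view]

end Computes

theorem computes_of_iset {d r v : ℕ} {c : Config} {I : Instr} (hP : P[c.pc]? = some I)
    (hI : I.exec c =
      some { c with pc := c.pc + 1, ireg := Function.update c.ireg r v }) (hd : d ≤ r) :
    Computes P d 1 c { c with pc := c.pc + 1, ireg := Function.update c.ireg r v } where
  run_eq := by rw [run_succ hP, hI, Option.bind_some, run]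
  ireg_eq _ hr' := Function.update_of_ne (hr'.trans_le hd).ne _ _
  imem_eq := rfl
  creg_eq _ _ := rfl
  cmem_eq := rfl

theorem computes_of_cset {d r : ℕ} {v : ℂ} {c : Config} {I : Instr} (hP : P[c.pc]? = some I)
    (hI : I.exec c =
      some { c with pc := c.pc + 1, creg := Function.update c.creg r v }) (hd : d ≤ r) :
    Computes P d 1 c { c with pc := c.pc + 1, creg := Function.update c.creg r v } where
  run_eq := by rw [run_succ hP, hI, Option.bind_some, run]
  ireg_eq _ _ := rfl
  imem_eq := rfl
  creg_eq _ hr' := Function.update_of_ne (hr'.trans_le hd).ne _ _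
  cmem_eq := rfl

/-- From line `pc` on, `P` has `t` instructions that bring about `get = val`, where `val` refers to
the state before their execution, without touching memories or registers below `d`. -/
def Delivers {α : Type*} (P : Program) (L : Layout ι κ) (d pc t : ℕ) (get : Config → α)
    (val : State ι κ → α) : Prop :=
  ∀ c : Config, c.pc = pc →
    ∃ c', Computes P d t c c' ∧ c'.pc = pc + t ∧ get c' = val (L.view c)

variable {L}

section Delivers

variable {α β : Type*} {d t t' : ℕ} {get : Config → α} {val : State ι κ → α}
  {get' : Config → β} {val' : State ι κ → β} {I : Instr}

theorem delivers_view (d pc : ℕ) : Delivers P L d pc 0 L.view id := fun c hc =>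
  ⟨c, ⟨rfl, fun _ _ => rfl, rfl, fun _ _ => rfl, rfl⟩, hc, rfl⟩

theorem Delivers.congr (h : Delivers P L d pc t get val)
    (hget : ∀ c c', Computes P d t c c' → get c' = val (L.view c) → get' c' = val' (L.view c)) :
    Delivers P L d pc t get' val' := fun c hc =>
  let ⟨c', h', hpc, hv⟩ := h c hc
  ⟨c', h', hpc, hget c c' h' hv⟩

theorem Delivers.iset {f : α → ℕ} (h : Delivers P L d pc t get val) (hP : P[pc + t]? = some I)
    (hI : ∀ c, I.exec c =
      some { c with pc := c.pc + 1, ireg := Function.update c.ireg d (f (get c)) }) :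
    Delivers P L d pc (t + 1) (fun c => c.ireg d) fun σ => f (val σ) := fun c hc => by
  obtain ⟨c', h', hpc, hv⟩ := h c hc
  rw [← hpc] at hP
  exact ⟨_, h'.trans (computes_of_iset hP (hI c') le_rfl), congrArg (· + 1) hpc,
    (Function.update_self ..).trans (congrArg f hv)⟩

theorem Delivers.cset {f : α → ℂ} (h : Delivers P L d pc t get val) (hP : P[pc + t]? = some I)
    (hI : ∀ c, I.exec c =
      some { c with pc := c.pc + 1, creg := Function.update c.creg d (f (get c)) }) :
    Delivers P L d pc (t + 1) (fun c => c.creg d) fun σ => f (val σ) := fun c hc => by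
  obtain ⟨c', h', hpc, hv⟩ := h c hc
  rw [← hpc] at hP
  exact ⟨_, h'.trans (computes_of_cset hP (hI c') le_rfl), congrArg (· + 1) hpc,
    (Function.update_self ..).trans (congrArg f hv)⟩

theorem Delivers.prod (h : Delivers P L d pc t get val)
    (h' : Delivers P L (d + 1) (pc + t) t' get' val')
    (hget : ∀ c c' t, Computes P (d + 1) t c c' → get c' = get c) (hd : L.bound ≤ d) :
    Delivers P L d pc (t + t') (fun c => (get c, get' c)) fun σ => (val σ, val' σ) := by
  intro c hc
  obtain ⟨c₁, h₁, hpc₁, hv₁⟩ := h c hc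
  obtain ⟨c₂, h₂, hpc₂, hv₂⟩ := h' c₁ hpc₁
  refine ⟨c₂, h₁.trans (h₂.mono d.le_succ), by rw [hpc₂, add_assoc], Prod.ext ?_ ?_⟩
  · exact (hget c₁ c₂ t' h₂).trans hv₁
  · exact hv₂.trans (congrArg val' (h₁.view_eq hd))

theorem HasCode.delivers_prod {l l' : Program} (h : HasCode P pc (l ++ l' ++ [I]))
    (ht : l.length = t) (ht' : l'.length = t')
    (hl : HasCode P pc l → Delivers P L d pc t get val)
    (hl' : HasCode P (pc + t) l' → Delivers P L (d + 1) (pc + t) t' get' val')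
    (hget : ∀ c c' t, Computes P (d + 1) t c c' → get c' = get c) (hd : L.bound ≤ d) :
    Delivers P L d pc (t + t') (fun c => (get c, get' c)) (fun σ => (val σ, val' σ)) ∧
      P[pc + (t + t')]? = some I := by
  rw [hasCode_append, hasCode_append, List.length_append, ht, ht'] at h
  exact ⟨(hl h.1.1).prod (hl' h.1.2) hget hd, (hasCode_cons.1 h.2).1⟩

end Delivers

theorem IExpr.delivers (e : IExpr ι) {d pc : ℕ} (hd : L.bound ≤ d)
    (h : HasCode P pc (e.compile L d)) :
    Delivers P L d pc e.size (fun c => c.ireg d) e.eval := by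
  induction e generalizing d pc with
  | const k =>
    exact (delivers_view d pc).iset (f := fun _ => k) (hasCode_cons.1 h).1 fun _ => rfl
  | var x =>
    obtain ⟨h₀, h₁⟩ := hasCode_cons.1 h
    have hconst := (delivers_view (L := L) d pc).iset (f := fun _ => 0) h₀ fun _ => rfl
    refine (hconst.congr (get' := fun c => c.ireg (L.ireg x) + c.ireg d)
      (val' := fun σ => σ.ireg x) fun c c' h hv => ?_).iset (f := id) (hasCode_cons.1 h₁).1
        fun _ => rfl
    rw [hv, h.ireg_eq _ ((L.ireg_lt x).trans_le hd)]
    rfl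
  | add a b iha ihb =>
    obtain ⟨hab, hI⟩ := h.delivers_prod (a.length_compile L d) (b.length_compile L (d + 1))
      (iha hd) (ihb (hd.trans d.le_succ)) (fun _ _ _ h => h.ireg_eq d d.lt_succ_self) hd
    exact hab.iset (f := fun v => v.1 + v.2) hI fun _ => rfl
  | sub a b iha ihb =>
    obtain ⟨hab, hI⟩ := h.delivers_prod (a.length_compile L d) (b.length_compile L (d + 1))
      (iha hd) (ihb (hd.trans d.le_succ)) (fun _ _ _ h => h.ireg_eq d d.lt_succ_self) hd
    exact hab.iset (f := fun v => v.1 - v.2) hI fun _ => rfl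
  | load a iha =>
    obtain ⟨ha, hI⟩ := hasCode_append.1 h
    rw [a.length_compile] at hI
    refine ((iha hd ha).congr (get' := fun c => c.imem (c.ireg d))
      (val' := fun σ => σ.imem (a.eval σ)) fun c c' h hv => ?_).iset (f := id)
        (hasCode_cons.1 hI).1 fun _ => rfl
    rw [hv, h.imem_eq]
    rfl

theorem CExpr.delivers (e : CExpr ι κ) {d pc : ℕ} (hd : L.bound ≤ d)
    (h : HasCode P pc (e.compile L d)) :
    Delivers P L d pc e.size (fun c => c.creg d) e.eval := by
  induction e generalizing d pc with
  | const k =>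
    exact (delivers_view d pc).cset (f := fun _ => (k : ℂ)) (hasCode_cons.1 h).1 fun _ => rfl
  | var x =>
    obtain ⟨h₀, h₁⟩ := hasCode_cons.1 h
    have hconst := (delivers_view (L := L) d pc).cset (f := fun _ => ((0 : ℕ) : ℂ)) h₀ fun _ => rfl
    refine (hconst.congr (get' := fun c => c.creg (L.creg x) + c.creg d)
      (val' := fun σ => σ.creg x) fun c c' h hv => ?_).cset (f := id) (hasCode_cons.1 h₁).1
        fun _ => rfl
    rw [hv, h.creg_eq _ ((L.creg_lt x).trans_le hd), Nat.cast_zero, add_zero]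
    rfl
  | add a b iha ihb =>
    obtain ⟨hab, hI⟩ := h.delivers_prod (a.length_compile L d) (b.length_compile L (d + 1))
      (iha hd) (ihb (hd.trans d.le_succ)) (fun _ _ _ h => h.creg_eq d d.lt_succ_self) hd
    exact hab.cset (f := fun v => v.1 + v.2) hI fun _ => rfl
  | mul a b iha ihb =>
    obtain ⟨hab, hI⟩ := h.delivers_prod (a.length_compile L d) (b.length_compile L (d + 1))
      (iha hd) (ihb (hd.trans d.le_succ)) (fun _ _ _ h => h.creg_eq d d.lt_succ_self) hd
    exact hab.cset (f := fun v => v.1 * v.2) hI fun _ => rfl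
  | load a =>
    obtain ⟨ha, hI⟩ := hasCode_append.1 h
    rw [a.length_compile] at hI
    refine ((a.delivers hd ha).congr (get' := fun c => c.cmem (c.ireg d))
      (val' := fun σ => σ.cmem (a.eval σ)) fun c c' h hv => ?_).cset (f := id)
        (hasCode_cons.1 hI).1 fun _ => rfl
    rw [hv, h.cmem_eq]
    rfl

/-- Started in `c`, the program `P` gets to line `pc` in `t` steps, with the variables and the
memories as in `σ` and the loop counters, in the registers between `L.bound` and `d`, unchanged. -/
def Performs (P : Program) (L : Layout ι κ) (d : ℕ) (c : Config) (t : ℕ) (σ : State ι κ)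
    (pc : ℕ) : Prop :=
  ∃ c', run P t c = some c' ∧ c'.pc = pc ∧ L.view c' = σ ∧
    ∀ r, L.bound ≤ r → r < d → c'.ireg r = c.ireg r

section Performs

variable {d t t' pc' : ℕ} {c c' : Config} {σ σ' : State ι κ} {I : Instr}

theorem Performs.trans (h : Performs P L d c t σ pc)
    (h' : ∀ c', c'.pc = pc → L.view c' = σ → Performs P L d c' t' σ' pc') :
    Performs P L d c (t + t') σ' pc' := by
  obtain ⟨c₁, hrun, hpc, hview, hreg⟩ := h
  obtain ⟨c₂, hrun', hpc', hview', hreg'⟩ := h' c₁ hpc hview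
  exact ⟨c₂, by rw [run_add, hrun, Option.bind_some, hrun'], hpc', hview',
    fun r hb hd => (hreg' r hb hd).trans (hreg r hb hd)⟩

theorem Computes.performs (h : Computes P d t c c') (hd : L.bound ≤ d) :
    Performs P L d c t (L.view c) c'.pc :=
  ⟨c', h.run_eq, rfl, h.view_eq hd, fun r _ hr => h.ireg_eq r hr⟩

theorem Computes.trans_performs (h : Computes P d t c c') (h' : Performs P L d c' t' σ pc) :
    Performs P L d c (t + t') σ pc :=
  let ⟨c₁, hrun, hpc, hview, hreg⟩ := h'
  ⟨c₁, by rw [run_add, h.run_eq, Option.bind_some, hrun], hpc, hview,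
    fun r hb hr => (hreg r hb hr).trans (h.ireg_eq r hr)⟩

theorem Delivers.performs {α : Type*} {get : Config → α} {val : State ι κ → α}
    (h : Delivers P L d c.pc t get val) (hd : L.bound ≤ d) (hP : P[c.pc + t]? = some I)
    (hI : ∀ c', L.view c' = L.view c → get c' = val (L.view c) →
      ∃ c'', I.exec c' = some c'' ∧ c''.pc = c'.pc + 1 ∧ L.view c'' = σ ∧
        ∀ r, L.bound ≤ r → c''.ireg r = c'.ireg r) :
    Performs P L d c (t + 1) σ (c.pc + (t + 1)) := by
  obtain ⟨c₁, h₁, hpc, hv⟩ := h c rfl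
  obtain ⟨c₂, hexec, hpc', rfl, hreg⟩ := hI c₁ (h₁.view_eq hd) hv
  rw [← hpc] at hP
  rw [← add_assoc, ← hpc, ← hpc']
  exact ⟨c₂, by rw [run_add, h₁.run_eq, Option.bind_some, run_succ hP, hexec]; rfl, rfl, rfl,
    fun r hb hr => (hreg r hb).trans (h₁.ireg_eq r hr)⟩

end Performs

theorem computes_of_jump {d l : ℕ} {c : Config} {I : Instr} (hP : P[c.pc]? = some I)
    (hI : I.exec c = some { c with pc := l }) : Computes P d 1 c { c with pc := l } where
  run_eq := by rw [run_succ hP, hI, Option.bind_some, run]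
  ireg_eq _ _ := rfl
  imem_eq := rfl
  creg_eq _ _ := rfl
  cmem_eq := rfl

section Loop

variable {d l l' : ℕ} {c : Config} {body : Program}

theorem exists_computes_exit (h : HasCode P l (loopCode d l l' body)) (hpc : c.pc = l)
    (hc : c.ireg d = 0) : ∃ c', Computes P d 3 c c' ∧ c'.pc = l' := by
  simp only [loopCode, hasCode_append, hasCode_cons] at h
  obtain ⟨⟨⟨hzero, htest, hexit, -⟩, -⟩, -⟩ := h
  subst hpc
  refine ⟨_, ((computes_of_iset hzero rfl d.le_succ).trans
    (computes_of_jump (l := c.pc + 2) htest ?_)).trans (computes_of_jump hexit rfl), rfl⟩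
  simp [Instr.exec, hc]

theorem exists_computes_enter {k : ℕ} (h : HasCode P l (loopCode d l l' body)) (hpc : c.pc = l)
    (hc : c.ireg d = k + 1) :
    ∃ c', Computes P d 4 c c' ∧ c'.pc = l + 5 ∧ c'.ireg d = k := by
  simp only [loopCode, hasCode_append, hasCode_cons] at h
  obtain ⟨⟨⟨hzero, htest, -, hone, hdec, -⟩, -⟩, -⟩ := h
  subst hpc
  refine ⟨_, (((computes_of_iset hzero rfl d.le_succ).trans
    (computes_of_jump (l := c.pc + 3) htest ?_)).trans (computes_of_iset hone rfl d.le_succ)).trans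
      (computes_of_iset hdec rfl le_rfl), rfl, ?_⟩
  · simp [Instr.exec, hc]
  · simp [hc]

end Loop

theorem Layout.view_update_ireg (L : Layout ι κ) [DecidableEq ι] (c : Config) (pc : ℕ) (x : ι)
    (v : ℕ) :
    L.view { c with pc := pc, ireg := Function.update c.ireg (L.ireg x) v } =
      { L.view c with ireg := Function.update (L.view c).ireg x v } := by
  simp only [view, Function.update_comp_eq_of_injective _ L.ireg.injective]

theorem Layout.view_update_creg (L : Layout ι κ) [DecidableEq κ] (c : Config) (pc : ℕ) (x : κ)
    (v : ℂ) :
    L.view { c with pc := pc, creg := Function.update c.creg (L.creg x) v } =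
      { L.view c with creg := Function.update (L.view c).creg x v } := by
  simp only [view, Function.update_comp_eq_of_injective _ L.creg.injective]

namespace Stmt

variable [DecidableEq ι] [DecidableEq κ]

theorem performs_loopCode {d l : ℕ} {S : Stmt ι κ} (hd : L.bound ≤ d)
    (hcode : HasCode P l (loopCode d l (l + S.size + 6) (S.compile L (d + 1) (l + 5))))
    (hS : ∀ c : Config, c.pc = l + 5 →
      Performs P L (d + 1) c (S.time (L.view c)) (S.exec (L.view c)) (l + 5 + S.size))
    (k : ℕ) {c : Config} (hpc : c.pc = l) (hc : c.ireg d = k) :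
    Performs P L d c (3 + ∑ j ∈ Finset.range k, (S.time (S.exec^[j] (L.view c)) + 5))
      (S.exec^[k] (L.view c)) (l + S.size + 6) := by
  induction k generalizing c with
  | zero =>
    obtain ⟨c₁, hexit, hpc₁⟩ := exists_computes_exit hcode hpc hc
    exact hpc₁ ▸ hexit.performs hd
  | succ k ih =>
    obtain ⟨c₁, henter, hpc₁, hc₁⟩ := exists_computes_enter hcode hpc hc
    obtain ⟨c₂, hrun, hpc₂, hview, hreg⟩ := hS c₁ hpc₁
    have hback : P[c₂.pc]? = some (.jump l) := by
      have := (hasCode_append.1 hcode).2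
      rw [hasCode_cons, List.length_append, length_compile] at this
      rw [hpc₂, ← this.1]
      congr 1
      simp +arith
    obtain ⟨c₃, hrun', hpc₃, hview', hreg'⟩ :=
      ih (c := { c₂ with pc := l }) rfl ((hreg d hd d.lt_succ_self).trans hc₁)
    have htime : 3 + ∑ j ∈ Finset.range (k + 1), (S.time (S.exec^[j] (L.view c)) + 5) =
        4 + (S.time (L.view c₁) +
          (3 + ∑ j ∈ Finset.range k, (S.time (S.exec^[j] (L.view c₂)) + 5) + 1)) := by
      rw [Finset.sum_range_succ', hview, henter.view_eq hd]
      simp only [Function.iterate_succ_apply, Function.iterate_zero_apply]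
      omega
    rw [htime, Function.iterate_succ_apply, ← henter.view_eq hd, ← hview]
    refine henter.trans_performs ⟨c₃, ?_, hpc₃, hview', fun r hb hr =>
      (hreg' r hb hr).trans (hreg r hb (hr.trans d.lt_succ_self))⟩
    rw [run_add, hrun, Option.bind_some, run_succ hback]
    exact hrun'

theorem performs_loop {e : IExpr ι} {S : Stmt ι κ} {d : ℕ} (hd : L.bound ≤ d)
    (hS : ∀ {c : Config}, HasCode P c.pc (S.compile L (d + 1) c.pc) →
      Performs P L (d + 1) c (S.time (L.view c)) (S.exec (L.view c)) (c.pc + S.size))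
    {c : Config} (h : HasCode P c.pc ((loop e S).compile L d c.pc)) :
    Performs P L d c ((loop e S).time (L.view c)) ((loop e S).exec (L.view c))
      (c.pc + (loop e S).size) := by
  obtain ⟨he, hloop⟩ := hasCode_append.1 h
  rw [e.length_compile] at hloop
  have hbody : ∀ c' : Config, c'.pc = c.pc + e.size + 5 →
      Performs P L (d + 1) c' (S.time (L.view c')) (S.exec (L.view c'))
        (c.pc + e.size + 5 + S.size) := by
    intro c' hpc
    rw [← hpc]
    refine hS ?_
    rw [hpc]
    exact (hasCode_append.1 (hasCode_append.1 hloop).1).2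
  obtain ⟨c₁, h₁, hpc₁, hcount⟩ := e.delivers hd he c rfl
  have := h₁.trans_performs (performs_loopCode hd hloop hbody (e.eval (L.view c)) hpc₁ hcount)
  rwa [h₁.view_eq hd, ← add_assoc, add_assoc c.pc, add_assoc c.pc] at this

theorem performs_compile (S : Stmt ι κ) {d : ℕ} (hd : L.bound ≤ d) {c : Config}
    (h : HasCode P c.pc (S.compile L d c.pc)) :
    Performs P L d c (S.time (L.view c)) (S.exec (L.view c)) (c.pc + S.size) := by
  have hd' := hd.trans d.le_succ
  induction S generalizing d c with
  | iset x e =>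
    obtain ⟨he, hI⟩ := h.delivers_prod (e.length_compile L d) (IExpr.length_compile L (d + 1) _)
      (e.delivers hd) (IExpr.delivers _ hd') (fun _ _ _ h => h.ireg_eq d d.lt_succ_self) hd
    refine he.performs hd hI fun c' hview hv => ⟨_, rfl, rfl, ?_, fun r hr =>
      Function.update_of_ne ((L.ireg_lt x).trans_le hr).ne' _ _⟩
    obtain ⟨hv, hzero⟩ := Prod.ext_iff.1 hv
    dsimp only at hv hzero
    rw [L.view_update_ireg, hview, hv, hzero, IExpr.eval, Nat.add_zero, exec]
  | cset x e =>
    obtain ⟨he, hI⟩ := h.delivers_prod (e.length_compile L d) (CExpr.length_compile L (d + 1) _)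
      (e.delivers hd) (CExpr.delivers _ hd') (fun _ _ _ h => h.creg_eq d d.lt_succ_self) hd
    refine he.performs hd hI fun c' hview hv => ⟨_, rfl, rfl, ?_, fun _ _ => rfl⟩
    obtain ⟨hv, hzero⟩ := Prod.ext_iff.1 hv
    dsimp only at hv hzero
    rw [L.view_update_creg, hview, hv, hzero, CExpr.eval, Nat.cast_zero, add_zero, exec]
  | istore a e =>
    obtain ⟨hae, hI⟩ := h.delivers_prod (a.length_compile L d) (e.length_compile L (d + 1))
      (a.delivers hd) (e.delivers hd') (fun _ _ _ h => h.ireg_eq d d.lt_succ_self) hd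
    refine hae.performs hd hI fun c' hview hv => ⟨_, rfl, rfl, ?_, fun _ _ => rfl⟩
    obtain ⟨ha, he⟩ := Prod.ext_iff.1 hv
    dsimp only at ha he
    rw [exec, ← ha, ← he, ← hview]
    rfl
  | cstore a e =>
    obtain ⟨hae, hI⟩ := h.delivers_prod (a.length_compile L d) (e.length_compile L (d + 1))
      (a.delivers hd) (e.delivers hd') (fun _ _ _ h => h.ireg_eq d d.lt_succ_self) hd
    refine hae.performs hd hI fun c' hview hv => ⟨_, rfl, rfl, ?_, fun _ _ => rfl⟩
    obtain ⟨ha, he⟩ := Prod.ext_iff.1 hv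
    dsimp only at ha he
    rw [exec, ← ha, ← he, ← hview]
    rfl
  | seq S T ihS ihT =>
    obtain ⟨hS, hT⟩ := hasCode_append.1 h
    rw [S.length_compile] at hT
    refine (ihS hd hS hd').trans fun c' hpc hview => ?_
    rw [← hpc] at hT
    have := ihT hd hT hd'
    rwa [hview, hpc, add_assoc] at this
  | loop e S ih => exact performs_loop hd (fun h => ih hd' h (hd'.trans (d + 1).le_succ)) h

end Stmt

theorem Stmt.haltsWith_compile [DecidableEq ι] [DecidableEq κ] (S : Stmt ι κ) (L : Layout ι κ)
    {x : κ} (hx : L.creg x = 0) {c : Config} (hc : c.pc = 0) :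
    HaltsWith (S.compile L L.bound 0) c (S.time (L.view c)) ((S.exec (L.view c)).creg x) := by
  obtain ⟨c', hrun, hpc, hview, -⟩ := S.performs_compile (P := S.compile L L.bound 0) le_rfl
    (c := c) (by rw [hc]; exact hasCode_self _)
  refine ⟨c', hrun, ?_, ?_⟩
  · rw [hpc, hc, zero_add, S.length_compile]
  · rw [← hview, ← hx]
    rfl

end Compilation

namespace Stmt

/-- The index variables to which a program assigns. -/
def iwrites : Stmt ι κ → List ι
  | iset x _ => [x]
  | seq S T => S.iwrites ++ T.iwrites
  | loop _ S => S.iwrites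
  | cset _ _ | istore _ _ | cstore _ _ => []

/-- The scalar variables to which a program assigns. -/
def cwrites : Stmt ι κ → List κ
  | cset x _ => [x]
  | seq S T => S.cwrites ++ T.cwrites
  | loop _ S => S.cwrites
  | iset _ _ | istore _ _ | cstore _ _ => []

/-- Whether a program contains a store to index memory. -/
def storesIndex : Stmt ι κ → Bool
  | istore _ _ => true
  | seq S T => S.storesIndex || T.storesIndex
  | loop _ S => S.storesIndex
  | iset _ _ | cset _ _ | cstore _ _ => false

/-- Whether a program contains a store to scalar memory. -/
def storesScalar : Stmt ι κ → Bool
  | cstore _ _ => true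
  | seq S T => S.storesScalar || T.storesScalar
  | loop _ S => S.storesScalar
  | iset _ _ | cset _ _ | istore _ _ => false

/-- `σ` and `τ` differ at most in variables to which `S` assigns and in memories to which `S`
stores. -/
structure Agree (S : Stmt ι κ) (σ τ : State ι κ) : Prop where
  ireg_eq : ∀ x ∉ S.iwrites, τ.ireg x = σ.ireg x
  imem_eq : S.storesIndex = false → τ.imem = σ.imem
  creg_eq : ∀ x ∉ S.cwrites, τ.creg x = σ.creg x
  cmem_eq : S.storesScalar = false → τ.cmem = σ.cmem

namespace Agree

variable {S S' T : Stmt ι κ} {σ τ υ : State ι κ}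

theorem refl (S : Stmt ι κ) (σ : State ι κ) : S.Agree σ σ :=
  ⟨fun _ _ => rfl, fun _ => rfl, fun _ _ => rfl, fun _ => rfl⟩

theorem trans (h : S.Agree σ τ) (h' : S.Agree τ υ) : S.Agree σ υ where
  ireg_eq x hx := (h'.ireg_eq x hx).trans (h.ireg_eq x hx)
  imem_eq hS := (h'.imem_eq hS).trans (h.imem_eq hS)
  creg_eq x hx := (h'.creg_eq x hx).trans (h.creg_eq x hx)
  cmem_eq hS := (h'.cmem_eq hS).trans (h.cmem_eq hS)

theorem seq (h : S.Agree σ τ) (h' : T.Agree τ υ) : (S.seq T).Agree σ υ := by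
  constructor
  · intro x hx
    rw [iwrites, List.mem_append, not_or] at hx
    exact (h'.ireg_eq x hx.2).trans (h.ireg_eq x hx.1)
  · intro hS
    rw [storesIndex, Bool.or_eq_false_iff] at hS
    exact (h'.imem_eq hS.2).trans (h.imem_eq hS.1)
  · intro x hx
    rw [cwrites, List.mem_append, not_or] at hx
    exact (h'.creg_eq x hx.2).trans (h.creg_eq x hx.1)
  · intro hS
    rw [storesScalar, Bool.or_eq_false_iff] at hS
    exact (h'.cmem_eq hS.2).trans (h.cmem_eq hS.1)

theorem loop {e : IExpr ι} (h : S.Agree σ τ) : (loop e S).Agree σ τ :=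
  ⟨h.ireg_eq, h.imem_eq, h.creg_eq, h.cmem_eq⟩

end Agree

variable [DecidableEq ι] [DecidableEq κ]

theorem agree_exec (S : Stmt ι κ) (σ : State ι κ) : S.Agree σ (S.exec σ) := by
  induction S generalizing σ with
  | iset x e =>
    exact ⟨fun _ hy => Function.update_of_ne (by simpa [iwrites] using hy) _ _, fun _ => rfl,
      fun _ _ => rfl, fun _ => rfl⟩
  | cset x e =>
    exact ⟨fun _ _ => rfl, fun _ => rfl,
      fun _ hy => Function.update_of_ne (by simpa [cwrites] using hy) _ _, fun _ => rfl⟩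
  | istore a e => exact ⟨fun _ _ => rfl, (nomatch ·), fun _ _ => rfl, fun _ => rfl⟩
  | cstore a e => exact ⟨fun _ _ => rfl, fun _ => rfl, fun _ _ => rfl, (nomatch ·)⟩
  | seq S T ihS ihT => exact (ihS σ).seq (ihT _)
  | loop e S ih =>
    refine Agree.loop ?_
    rw [exec]
    induction e.eval σ with
    | zero => exact Agree.refl S σ
    | succ k ihk =>
      rw [Function.iterate_succ_apply']
      exact ihk.trans (ih _)

/-- Executed in the state `σ`, the program `S` takes at most `t` steps and leads to a state that
satisfies `Q`. -/
def Ensures (S : Stmt ι κ) (σ : State ι κ) (t : ℕ) (Q : State ι κ → Prop) : Prop :=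
  Q (S.exec σ) ∧ S.time σ ≤ t

/-- `if a ≤ b then S`, as a loop with `1 - (a - b)` rounds. -/
def ifLE (a b : IExpr ι) (S : Stmt ι κ) : Stmt ι κ :=
  loop (1 - (a - b)) S

namespace Ensures

variable {S T : Stmt ι κ} {σ : State ι κ} {t t' t'' : ℕ}
  {Q R : State ι κ → Prop}

theorem mono (h : S.Ensures σ t Q) (ht : t ≤ t') (hQ : ∀ τ, S.Agree σ τ → Q τ → R τ) :
    S.Ensures σ t' R :=
  ⟨hQ _ (S.agree_exec σ) h.1, h.2.trans ht⟩

theorem seq (h : S.Ensures σ t Q)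
    (h' : ∀ τ, S.Agree σ τ → Q τ → T.Ensures τ t' R) (ht : t' + t ≤ t'') :
    (S.seq T).Ensures σ t'' R :=
  have h'' := h' _ (S.agree_exec σ) h.1
  ⟨h''.1, (Nat.add_comm .. ▸ add_le_add h''.2 h.2).trans ht⟩

theorem loop {e : IExpr ι} {k : ℕ} {I : ℕ → State ι κ → Prop} (hk : e.eval σ = k) (h0 : I 0 σ)
    (hstep : ∀ j τ, j < k → S.Agree σ τ → I j τ → S.Ensures τ t (I (j + 1)))
    (ht : k * (t + 5) + (e.size + 3) ≤ t') (hQ : ∀ τ, S.Agree σ τ → I k τ → Q τ) :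
    (loop e S).Ensures σ t' Q := by
  subst hk
  have hinv : ∀ j ≤ e.eval σ, S.Agree σ (S.exec^[j] σ) ∧ I j (S.exec^[j] σ) := by
    intro j hj
    induction j with
    | zero => exact ⟨Agree.refl S σ, h0⟩
    | succ j ih =>
      obtain ⟨hagree, hI⟩ := ih (j.le_succ.trans hj)
      rw [Function.iterate_succ_apply']
      exact ⟨hagree.trans (S.agree_exec _), (hstep j _ hj hagree hI).1⟩
  refine ⟨hQ _ (hinv _ le_rfl).1 (hinv _ le_rfl).2, le_trans ?_ ht⟩
  rw [time, Nat.add_comm]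
  refine Nat.add_le_add_right ?_ _
  refine (Finset.sum_le_card_nsmul (Finset.range (e.eval σ)) _ (t + 5) fun j hj => ?_).trans ?_
  · rw [Finset.mem_range] at hj
    obtain ⟨hagree, hI⟩ := hinv j hj.le
    exact Nat.add_le_add_right (hstep j _ hj hagree hI).2 5
  · rw [Finset.card_range, smul_eq_mul]

theorem ifLE {a b : IExpr ι} (hle : a.eval σ ≤ b.eval σ → S.Ensures σ t Q)
    (hlt : b.eval σ < a.eval σ → Q σ) (ht' : t + (a.size + b.size + 11) ≤ t') :
    (ifLE a b S).Ensures σ t' Q := by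
  have hsize : (1 - (a - b) : IExpr ι).size = 1 + (a.size + b.size + 1) + 1 := rfl
  rcases le_or_gt (a.eval σ) (b.eval σ) with h | h
  · have heval : (1 - (a - b) : IExpr ι).eval σ = 1 := by
      rw [IExpr.eval_sub, IExpr.eval_sub, Nat.sub_eq_zero_of_le h, IExpr.eval_ofNat]
    obtain ⟨hQ, ht⟩ := hle h
    refine ⟨?_, ?_⟩
    · rw [Stmt.ifLE, exec, heval]
      exact hQ
    · rw [Stmt.ifLE, time, heval, Finset.sum_range_one, hsize, Function.iterate_zero_apply]
      omega
  · have heval : (1 - (a - b) : IExpr ι).eval σ = 0 := by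
      simp only [IExpr.eval_sub, IExpr.eval_ofNat]
      omega
    refine ⟨?_, ?_⟩
    · rw [Stmt.ifLE, exec, heval]
      exact hlt h
    · rw [Stmt.ifLE, time, heval, Finset.sum_range_zero, hsize]
      omega

end Ensures

end Stmt

end Language

section Algorithm

/-- The index variables. The input provides `n` and `w`; index memory holds the multiplicities,
read as `0` from cell `n` to cell `n + w`, and the powers of `c + 1` from cell `n + w + 1` on.
Scalar memory holds the matrix, of which `row` is the first cell of row `i`, followed by the
tables of the vertices `n, …, 0`: the table of `i` starts at `tab` and is written at `pos`, that of
`i + 1` is read from `prev` on. Entry `(c + 1) * y + r` of a table has `r` copies of its first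
vertex. -/
inductive IVar
  | n | w | c | i | e | y | pow | step | tab | prev | row | pos | rem
  deriving DecidableEq

/-- The scalar variables; `r` counts the copies of the vertex `i` that remain after matching one. -/
inductive CVar
  | out | acc | term | r
  deriving DecidableEq

/-- Each variable has the register with its position in the list above; the machine expects the
input in the first two index registers and the output in the first scalar register. -/
def layout : Layout IVar CVar where
  ireg := ⟨IVar.ctorIdx, fun x x' h => by cases x <;> cases x' <;> first | rfl | cases h⟩
  creg := ⟨CVar.ctorIdx, fun x x' h => by cases x <;> cases x' <;> first | rfl | cases h⟩
  bound := 13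
  ireg_lt x := by cases x <;> decide
  creg_lt x := by cases x <;> decide

local infixr:60 " ;; " => Stmt.seq
local infix:62 " ≔ " => Stmt.iset
local infix:62 " ≔ᶜ " => Stmt.cset
local infix:62 " ↤ " => Stmt.istore
local infix:62 " ↤ᶜ " => Stmt.cstore

section Code

open IVar CVar

/-- The cell that contains `(c + 1) ^ e`. -/
def powCell (e : IExpr IVar) : IExpr IVar := .load (n + w + 1 + e)

/-- Sets `c` to the maximum of the multiplicities, as `max c s = c + (s - c)`. -/
def computeMax : Stmt IVar CVar :=
  (c ≔ 0 ;; e ≔ 0) ;;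
  .loop n (c ≔ c + (.load e - c) ;; e ≔ e + 1)

/-- Stores `(c + 1) ^ e`, held in `pow`, and proceeds to the next `e`. -/
def storePower : Stmt IVar CVar :=
  (n + w + 1 + e ↤ pow ;; step ≔ pow) ;;
  .loop c (pow ≔ pow + step) ;;
  e ≔ e + 1

/-- Tabulates the powers of `c + 1` up to the exponent `w + 1`. -/
def storePowers : Stmt IVar CVar :=
  (pow ≔ 1 ;; e ≔ 0) ;; .loop (w + 2) storePower

/-- Stores the table of the vertex `n` behind the matrix: with no vertex left, only entry `0` is
ever read. -/
def storeLastTable : Stmt IVar CVar :=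
  tab ≔ 0 ;;
  .loop n (tab ≔ tab + n) ;;
  row ≔ tab ;; i ≔ n ;; tab ↤ᶜ 1

/-- Extracts digit `e` of `rem` and adds `term` as often to `acc`. -/
def addDigit : Stmt IVar CVar :=
  .loop c (.ifLE (powCell e) rem (rem ≔ rem - powCell e ;; acc ≔ᶜ acc + term))

/-- Decreases `e` and adds the contribution of the vertex `i + e + 1` to `acc`: its multiplicity is
digit `e` of `rem`. -/
def addNeighbour : Stmt IVar CVar :=
  (e ≔ e - 1 ;; term ≔ᶜ .load (row + i + e + 1) * .load (pos - 1 - powCell (e + 1))) ;;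
  addDigit

/-- Adds the contributions of the vertices `i + w, …, i + 1` to `acc`. Since there is no division,
the digits of `y` are split off from the top. -/
def addNeighbours : Stmt IVar CVar :=
  (rem ≔ y ;; e ≔ w) ;; .loop w addNeighbour

/-- Computes the next entry of the table of `i` by expansion along the row of a copy of `i`. -/
def computeEntry : Stmt IVar CVar :=
  acc ≔ᶜ .load (row + i) * (.load (pos - 1) + r * .load (pos - 2)) ;;
  addNeighbours ;;
  pos ↤ᶜ acc ;; pos ≔ pos + 1 ;; r ≔ᶜ r + 1

/-- Computes the entries `(c + 1) * y, …, (c + 1) * y + c` of the table of `i`; the first one has no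
copy of `i` and is read off the table of `i + 1`. -/
def computeBlock : Stmt IVar CVar :=
  (pos ↤ᶜ .load (prev + y) ;; pos ≔ pos + 1 ;; r ≔ᶜ 0) ;;
  .loop c computeEntry ;;
  y ≔ y + 1

/-- Passes from the table of `i + 1` to that of `i`. All entries read from the former have the full
multiplicity of `i + w + 1` as their last digit, which `prev` takes into account. -/
def openTable : Stmt IVar CVar :=
  (i ≔ i - 1 ;; row ≔ row - n ;; prev ≔ tab) ;;
  .loop (.load (i + w + 1)) (prev ≔ prev + powCell w) ;;
  tab ≔ tab + powCell (w + 1) ;; pos ≔ tab ;; y ≔ 0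

/-- Computes the table of `i` from that of `i + 1`. -/
def computeTable : Stmt IVar CVar :=
  openTable ;; .loop (powCell w) computeBlock

/-- Computes the tables of the vertices `n - 1, …, 0`. -/
def computeTables : Stmt IVar CVar :=
  .loop n computeTable

/-- Looks up the entry of the table of the vertex `0` that has the given multiplicities. -/
def readResult : Stmt IVar CVar :=
  (pos ≔ tab ;; e ≔ 0) ;;
  .loop (w + 1) (
    .loop (.load e) (pos ≔ pos + powCell e) ;;
    e ≔ e + 1) ;;
  out ≔ᶜ .load pos

/-- The algorithm: dynamic programming over the tables of the vertices, from the last to the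
first. -/
def loopHafnian : Stmt IVar CVar :=
  computeMax ;; storePowers ;; storeLastTable ;; computeTables ;; readResult

end Code

section Specification

variable {n w c : ℕ} {S : ℕ → ℕ} {σ τ : State IVar CVar}

/-- The input and the results of `computeMax` and `storePowers` are in place; the multiplicities
`S v` are continued by zero. -/
structure Ready (n w c : ℕ) (S : ℕ → ℕ) (σ : State IVar CVar) : Prop where
  n_eq : σ.ireg .n = n
  w_eq : σ.ireg .w = w
  c_eq : σ.ireg .c = c
  mult_eq : ∀ v ≤ n + w, σ.imem v = S v
  pow_eq : ∀ e ≤ w + 1, σ.imem (n + w + 1 + e) = (c + 1) ^ e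

theorem Ready.of_agree (h : Ready n w c S σ) {T : Stmt IVar CVar} (hT : T.Agree σ τ)
    (hn : .n ∉ T.iwrites := by decide) (hw : .w ∉ T.iwrites := by decide)
    (hc : .c ∉ T.iwrites := by decide) (hmem : T.storesIndex = false := by decide) :
    Ready n w c S τ where
  n_eq := (hT.ireg_eq _ hn).trans h.n_eq
  w_eq := (hT.ireg_eq _ hw).trans h.w_eq
  c_eq := (hT.ireg_eq _ hc).trans h.c_eq
  mult_eq v hv := hT.imem_eq hmem ▸ h.mult_eq v hv
  pow_eq e he := hT.imem_eq hmem ▸ h.pow_eq e he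

theorem Ready.eval_powCell (h : Ready n w c S σ) {a : IExpr IVar} {e : ℕ} (ha : a.eval σ = e)
    (he : e ≤ w + 1) : (powCell a).eval σ = (c + 1) ^ e := by
  rw [← h.pow_eq e he, ← ha, ← h.n_eq, ← h.w_eq]
  rfl

-- The numerals in the time bounds are the sizes of the compiled fragments.
theorem addDigit_ensures (h : Ready n w c S σ) {e : ℕ} (he : σ.ireg .e = e) (hew : e ≤ w)
    {x : ℕ} (hx : σ.ireg .rem = x) (hxc : x < (c + 1) ^ e * (c + 1)) :
    addDigit.Ensures σ (c * 52 + 5) fun τ =>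
      τ.ireg .rem = x % (c + 1) ^ e ∧
        τ.creg .acc = σ.creg .acc + (x / (c + 1) ^ e : ℕ) * σ.creg .term := by
  set p := (c + 1) ^ e
  refine Stmt.Ensures.loop (t := 47) (I := fun j τ => ∃ d, (d = j ∨ τ.ireg .rem < p) ∧
      τ.ireg .rem + p * d = x ∧ τ.creg .acc = σ.creg .acc + d * σ.creg .term)
    h.c_eq ⟨0, .inl rfl, by simp [hx], by simp⟩ ?_ le_rfl ?_
  · rintro j τ - hτ ⟨d, hd, hrem, hacc⟩
    have hpow : (powCell IVar.e).eval τ = p := (h.of_agree hτ).eval_powCell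
      ((hτ.ireg_eq .e (by decide)).trans he) (hew.trans w.le_succ)
    have hterm := hτ.creg_eq .term (by decide)
    refine Stmt.Ensures.ifLE (fun hle => ⟨?_, le_rfl⟩) (fun hlt => ?_) le_rfl
    · have hle' : p ≤ τ.ireg .rem := hpow ▸ hle
      refine ⟨d + 1, .inl (congrArg (· + 1) (hd.resolve_right hle'.not_gt)), ?_, ?_⟩
      · simp [Stmt.exec, hpow, mul_add]
        omega
      · simp [Stmt.exec, hacc, hterm]
        ring
    · exact ⟨d, .inr (hpow ▸ hlt), hrem, hacc⟩
  · rintro τ - ⟨d, hd, hrem, hacc⟩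
    rw [mul_add_one] at hxc
    have hlt : τ.ireg .rem < p := hd.elim (by rintro rfl; omega) id
    obtain ⟨hdiv, hmod⟩ := (Nat.div_mod_unique (Nat.pow_pos c.succ_pos)).2 ⟨hrem, hlt⟩
    rw [hdiv, hmod]
    exact ⟨rfl, hacc⟩

theorem addNeighbour_ensures (h : Ready n w c S σ) {e : ℕ} (he : σ.ireg .e = e + 1) (hew : e < w)
    {x : ℕ} (hx : σ.ireg .rem = x) (hxc : x < (c + 1) ^ (e + 1)) :
    addNeighbour.Ensures σ (c * 52 + 44) fun τ =>
      τ.ireg .e = e ∧ τ.ireg .rem = x % (c + 1) ^ e ∧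
        τ.creg .acc = σ.creg .acc + (x / (c + 1) ^ e : ℕ) *
          (σ.cmem (σ.ireg .row + σ.ireg .i + e + 1) *
            σ.cmem (σ.ireg .pos - 1 - (c + 1) ^ (e + 1))) := by
  refine Stmt.Ensures.seq (t' := c * 52 + 5)
    (Q := fun τ => τ.ireg IVar.e = e ∧ τ.creg CVar.term =
      σ.cmem (σ.ireg .row + σ.ireg .i + e + 1) * σ.cmem (σ.ireg .pos - 1 - (c + 1) ^ (e + 1)))
    ⟨⟨?_, ?_⟩, le_rfl⟩ (fun τ hτ ⟨he, hterm⟩ => ?_) le_rfl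
  · simp [Stmt.exec, he]
  · simp [Stmt.exec, powCell, he, h.n_eq, h.w_eq, h.pow_eq (e + 1) (by omega)]
  · refine (addDigit_ensures (h.of_agree hτ) he hew.le ((hτ.ireg_eq .rem (by decide)).trans hx)
      (pow_succ (c + 1) e ▸ hxc)).mono le_rfl fun υ hυ ⟨hrem, hacc⟩ =>
        ⟨(hυ.ireg_eq .e (by decide)).trans he, hrem, ?_⟩
    rw [hacc, hterm, hτ.creg_eq .acc (by decide)]

theorem addNeighbours_ensures (h : Ready n w c S σ) {y : ℕ} (hy : σ.ireg .y = y)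
    (hyw : y < (c + 1) ^ w) :
    addNeighbours.Ensures σ (w * (c * 52 + 49) + 13) fun τ =>
      τ.creg .acc = σ.creg .acc + ∑ e ∈ Finset.range w, ((y / (c + 1) ^ e % (c + 1) : ℕ) : ℂ) *
        (σ.cmem (σ.ireg .row + σ.ireg .i + e + 1) *
          σ.cmem (σ.ireg .pos - 1 - (c + 1) ^ (e + 1))) := by
  set f : ℕ → ℂ := fun e => ((y / (c + 1) ^ e % (c + 1) : ℕ) : ℂ) *
    (σ.cmem (σ.ireg .row + σ.ireg .i + e + 1) * σ.cmem (σ.ireg .pos - 1 - (c + 1) ^ (e + 1)))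
  refine Stmt.Ensures.seq (t' := w * (c * 52 + 49) + 5)
    (Q := fun τ => τ.ireg IVar.rem = y ∧ τ.ireg IVar.e = w)
    ⟨⟨hy, h.w_eq⟩, le_rfl⟩ (fun τ hτ ⟨hrem, he⟩ => ?_) le_rfl
  replace h := h.of_agree hτ
  refine Stmt.Ensures.loop (t := c * 52 + 44)
    (I := fun j υ => υ.ireg .e = w - j ∧ υ.ireg .rem = y % (c + 1) ^ (w - j) ∧
      υ.creg .acc = τ.creg .acc + ∑ e ∈ Finset.range j, f (w - 1 - e))
    h.w_eq ⟨he, hrem.trans (Nat.mod_eq_of_lt hyw).symm, by simp⟩ ?_ le_rfl ?_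
  · rintro j υ hj hυ ⟨he, hrem, hacc⟩
    obtain ⟨e, hwj⟩ : ∃ e, w - j = e + 1 := Nat.exists_eq_succ_of_ne_zero (by omega)
    rw [hwj] at he hrem
    have hframe : ∀ x ∈ [IVar.row, .i, .pos], υ.ireg x = σ.ireg x := by
      simp +decide [hυ.ireg_eq, hτ.ireg_eq]
    simp only [List.forall_mem_cons] at hframe
    obtain ⟨hrow, hi, hpos, -⟩ := hframe
    have hcmem : υ.cmem = σ.cmem := (hυ.cmem_eq rfl).trans (hτ.cmem_eq rfl)
    have hdigit : y % (c + 1) ^ (e + 1) / (c + 1) ^ e = y / (c + 1) ^ e % (c + 1) := by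
      rw [pow_succ, Nat.mod_mul_right_div_self]
    refine (addNeighbour_ensures (h.of_agree hυ) he (by omega) hrem
      (Nat.mod_lt _ (Nat.pow_pos c.succ_pos))).mono le_rfl fun φ _ ⟨he', hrem', hacc'⟩ => ?_
    rw [Nat.sub_succ', hwj, Nat.add_sub_cancel]
    refine ⟨he', hrem'.trans (Nat.mod_mod_of_dvd _ (pow_dvd_pow _ e.le_succ)), ?_⟩
    rw [hacc', hdigit, hacc, hrow, hi, hpos, hcmem, Finset.sum_range_succ, add_assoc,
      show w - 1 - j = e by omega]
  · rintro υ - ⟨-, -, hacc⟩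
    rw [hacc, Finset.sum_range_reflect, hτ.creg_eq .acc (by decide)]

theorem computeEntry_ensures (h : Ready n w c S σ) {y : ℕ} (hy : σ.ireg .y = y)
    (hyw : y < (c + 1) ^ w) :
    computeEntry.Ensures σ (w * (c * 52 + 49) + 53) fun τ =>
      τ.ireg .pos = σ.ireg .pos + 1 ∧ τ.creg .r = σ.creg .r + 1 ∧
        τ.cmem = Function.update σ.cmem (σ.ireg .pos)
          (σ.cmem (σ.ireg .row + σ.ireg .i) *
              (σ.cmem (σ.ireg .pos - 1) + σ.creg .r * σ.cmem (σ.ireg .pos - 2)) +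
            ∑ e ∈ Finset.range w, ((y / (c + 1) ^ e % (c + 1) : ℕ) : ℂ) *
              (σ.cmem (σ.ireg .row + σ.ireg .i + e + 1) *
                σ.cmem (σ.ireg .pos - 1 - (c + 1) ^ (e + 1)))) := by
  refine Stmt.Ensures.seq (t := 23) (t' := w * (c * 52 + 49) + 30)
    (Q := fun τ => τ.creg CVar.acc = σ.cmem (σ.ireg IVar.row + σ.ireg .i) *
      (σ.cmem (σ.ireg .pos - 1) + σ.creg .r * σ.cmem (σ.ireg .pos - 2)))
    ⟨rfl, le_rfl⟩ (fun τ hτ hacc => ?_) le_rfl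
  refine Stmt.Ensures.seq (t' := 17) (addNeighbours_ensures (h.of_agree hτ)
      ((hτ.ireg_eq .y (by decide)).trans hy) hyw)
    (fun υ hυ hacc' => ?_) (by omega)
  have hpos : υ.ireg .pos = σ.ireg .pos :=
    (hυ.ireg_eq .pos (by decide)).trans (hτ.ireg_eq .pos (by decide))
  refine ⟨⟨?_, ?_, ?_⟩, le_rfl⟩
  · simp [Stmt.exec, hpos]
  · simp [Stmt.exec, (hυ.creg_eq .r (by decide)).trans (hτ.creg_eq .r (by decide))]
  · simp [Stmt.exec, hpos, hacc', hacc, hυ.cmem_eq rfl, hτ.cmem_eq rfl,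
      hτ.ireg_eq .pos (by decide), hτ.ireg_eq .row (by decide), hτ.ireg_eq .i (by decide)]

theorem openTable_ensures (h : Ready n w c S σ) {i : ℕ} (hi : σ.ireg .i = i + 1) (hin : i < n)
    (hSc : ∀ v, S v ≤ c) :
    openTable.Ensures σ (c * 21 + 53) fun τ =>
      τ.ireg .i = i ∧ τ.ireg .row = σ.ireg .row - n ∧
        τ.ireg .prev = σ.ireg .tab + S (i + w + 1) * (c + 1) ^ w ∧
          τ.ireg .tab = σ.ireg .tab + (c + 1) ^ (w + 1) ∧
            τ.ireg .pos = σ.ireg .tab + (c + 1) ^ (w + 1) ∧ τ.ireg .y = 0 := by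
  refine Stmt.Ensures.seq (t := 17) (t' := c * 21 + 36)
    (Q := fun τ => τ.ireg IVar.i = i ∧ τ.ireg .row = σ.ireg .row - n ∧ τ.ireg .prev = σ.ireg .tab)
    ⟨by simp [Stmt.exec, hi, h.n_eq], le_rfl⟩ (fun τ hτ ⟨hi, hrow, hprev⟩ => ?_) le_rfl
  replace h := h.of_agree hτ
  have htab := hτ.ireg_eq .tab (by decide)
  refine Stmt.Ensures.seq (t := c * 21 + 11) (t' := 25)
    (Q := fun υ => υ.ireg IVar.prev = σ.ireg IVar.tab + S (i + w + 1) * (c + 1) ^ w)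
    (Stmt.Ensures.loop (t := 16)
      (I := fun j υ => υ.ireg IVar.prev = σ.ireg IVar.tab + j * (c + 1) ^ w)
      (k := S (i + w + 1)) ?_ (by simp [hprev]) (fun j υ _ hυ hprev => ⟨?_, le_rfl⟩)
      (Nat.add_le_add_right (Nat.mul_le_mul_right 21 (hSc _)) 11) fun _ _ => id)
    (fun υ hυ hprev => ⟨?_, le_rfl⟩) (by omega)
  · simp [hi, h.w_eq, h.mult_eq (i + w + 1) (by omega)]
  · replace h := h.of_agree hυ
    have hpow : (powCell IVar.w).eval υ = (c + 1) ^ w := h.eval_powCell h.w_eq w.le_succ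
    simp [Stmt.exec, hpow, hprev, add_assoc, add_one_mul]
  · replace h := h.of_agree hυ
    have hpow : (powCell (IVar.w + 1)).eval υ = (c + 1) ^ (w + 1) :=
      h.eval_powCell (by simp [h.w_eq]) le_rfl
    simp [Stmt.exec, hpow, hprev, (hυ.ireg_eq .i (by decide)).trans hi,
      (hυ.ireg_eq .row (by decide)).trans hrow, (hυ.ireg_eq .tab (by decide)).trans htab]

section Filling

variable {A : Matrix (Fin n) (Fin n) ℂ} {hA : A.IsSymm}

/-- The first `N` entries of the table for `i` have been stored from cell `q` on, and the table for
`i + 1` is in the cells from `p` on. -/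
structure Filling (A : Matrix (Fin n) (Fin n) ℂ) (hA : A.IsSymm) (S : ℕ → ℕ) (w c : ℕ) (i : Fin n)
    (p q N : ℕ) (σ : State IVar CVar) : Prop extends Ready n w c S σ where
  matrix_eq : ∀ j k : Fin n, σ.cmem (n * j + k) = A j k
  i_eq : σ.ireg .i = i
  row_eq : σ.ireg .row = n * i
  pos_eq : σ.ireg .pos = q + N
  prev_eq : σ.ireg .prev = p + S (i + w + 1) * (c + 1) ^ w
  matrix_le : n * n ≤ p
  prev_le : p + (c + 1) ^ (w + 1) ≤ q
  isTable_prev : IsTable A hA S w (c + 1) (i + 1) ((c + 1) ^ (w + 1)) σ.cmem p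
  isTable : IsTable A hA S w (c + 1) i N σ.cmem q

theorem mul_add_lt_mul_self (j k : Fin n) : n * j + k < n * n :=
  (Nat.add_lt_add_left k.2 _).trans_le (Nat.mul_succ n j ▸ Nat.mul_le_mul_left n j.2)

theorem Filling.store {i : Fin n} {p q N : ℕ} (h : Filling A hA S w c i p q N σ)
    {T : Stmt IVar CVar} (hT : T.Agree σ τ) (hpos : τ.ireg .pos = σ.ireg .pos + 1) {v : ℂ}
    (hcmem : τ.cmem = Function.update σ.cmem (σ.ireg .pos) v)
    (hv : ∀ m, InWindow S w i m → windowCode (c + 1) i (w + 1) m = N → v = repeatedLhaf A hA m)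
    (hwrites : ∀ x ∈ [IVar.n, .w, .c, .i, .row, .prev], x ∉ T.iwrites := by decide)
    (hmem : T.storesIndex = false := by decide) :
    Filling A hA S w c i p q (N + 1) τ := by
  simp only [List.forall_mem_cons] at hwrites
  obtain ⟨hn, hw, hc, hi, hrow, hprev, -⟩ := hwrites
  have hlt : ∀ a < q + N, τ.cmem a = σ.cmem a := fun a ha => by
    rw [hcmem, h.pos_eq, Function.update_of_ne ha.ne]
  have hle := h.matrix_le
  have hle' := h.prev_le
  exact
  { h.toReady.of_agree hT hn hw hc hmem with
    matrix_eq := fun j k => by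
      have hjk := mul_add_lt_mul_self j k
      rw [hlt _ (by omega), h.matrix_eq]
    i_eq := (hT.ireg_eq _ hi).trans h.i_eq
    row_eq := (hT.ireg_eq _ hrow).trans h.row_eq
    pos_eq := by rw [hpos, h.pos_eq, add_assoc]
    prev_eq := (hT.ireg_eq _ hprev).trans h.prev_eq
    matrix_le := hle
    prev_le := hle'
    isTable_prev := h.isTable_prev.congr fun a ha => hlt a (by omega)
    isTable := (h.isTable.congr hlt).succ fun m hm hcode => by
      rw [hcmem, h.pos_eq, Function.update_self, hv m hm hcode] }

variable {i : Fin n} {p q : ℕ} {y r : ℕ}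

theorem Filling.computeEntry_ensures (hband : IsBanded A w) (hSc : ∀ v, S v ≤ c)
    (hS : ∀ v ≥ n, S v = 0) (h : Filling A hA S w c i p q ((c + 1) * y + r + 1) σ)
    (hy : σ.ireg .y = y) (hyw : y < (c + 1) ^ w) (hr : σ.creg .r = r) (hrc : r < c) :
    computeEntry.Ensures σ (w * (c * 52 + 49) + 53) fun τ =>
      Filling A hA S w c i p q ((c + 1) * y + (r + 1) + 1) τ ∧ τ.creg .r = (r + 1 : ℕ) := by
  refine (LoopHaf.computeEntry_ensures h.toReady hy hyw).mono le_rfl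
    fun τ hτ ⟨hpos, hr', hcmem⟩ => ⟨h.store hτ hpos hcmem fun m hm hcode => ?_, by simp [hr', hr]⟩
  rw [h.isTable.repeatedLhaf_eq_of_succ (fun v => Nat.lt_add_one_of_le (hSc v)) hm hband hS i.2
    (a := fun j => σ.cmem (n * i + j)) (h.matrix_eq i) (Nat.add_lt_add_right hrc 1) hcode,
    h.pos_eq, h.row_eq, h.i_eq, hr]
  simp only [← add_assoc, Nat.add_sub_cancel, Nat.reduceSubDiff]

theorem Filling.computeBlock_ensures (hband : IsBanded A w) (hSc : ∀ v, S v ≤ c)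
    (hS : ∀ v ≥ n, S v = 0) (h : Filling A hA S w c i p q ((c + 1) * y) σ)
    (hy : σ.ireg .y = y) (hyw : y < (c + 1) ^ w) :
    computeBlock.Ensures σ (c * (w * (c * 52 + 49) + 58) + 29) fun τ =>
      Filling A hA S w c i p q ((c + 1) * (y + 1)) τ ∧ τ.ireg .y = y + 1 := by
  refine Stmt.Ensures.seq (t := 18) (t' := c * (w * (c * 52 + 49) + 58) + 11)
    (Q := fun τ => Filling A hA S w c i p q ((c + 1) * y + 0 + 1) τ ∧ τ.creg CVar.r = (0 : ℕ))
    ⟨?_, le_rfl⟩ (fun τ hτ ⟨hfill, hr⟩ => ?_) le_rfl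
  · refine ⟨h.store (Stmt.agree_exec _ σ) rfl rfl fun m hm hcode => ?_, by simp [Stmt.exec]⟩
    rw [h.isTable_prev.repeatedLhaf_eq_of_zero (fun v => Nat.lt_add_one_of_le (hSc v)) hm hcode]
    simp [h.prev_eq, hy, ← add_assoc, add_right_comm]
  refine Stmt.Ensures.seq (t' := 6)
    (Stmt.Ensures.loop (t := w * (c * 52 + 49) + 53) (t' := c * (w * (c * 52 + 49) + 58) + 5)
      (I := fun j υ => Filling A hA S w c i p q ((c + 1) * y + j + 1) υ ∧ υ.creg CVar.r = j)
      hfill.c_eq ⟨hfill, hr⟩ (fun j υ hj hυ ⟨hfill, hr⟩ => ?_) le_rfl fun υ _ hυ => hυ.1)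
    (fun υ hυ hfill => ⟨⟨{ hfill with }, ?_⟩, le_rfl⟩) (by omega)
  · exact hfill.computeEntry_ensures hband hSc hS
      ((hυ.ireg_eq .y (by decide)).trans ((hτ.ireg_eq .y (by decide)).trans hy)) hyw hr hj
  · simp [Stmt.exec, hυ.ireg_eq .y (by decide), hτ.ireg_eq .y (by decide), hy]

/-- The table for `i`, from cell `q` on, is complete. -/
structure HasTable (A : Matrix (Fin n) (Fin n) ℂ) (hA : A.IsSymm) (S : ℕ → ℕ) (w c i q : ℕ)
    (σ : State IVar CVar) : Prop extends Ready n w c S σ where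
  matrix_eq : ∀ j k : Fin n, σ.cmem (n * j + k) = A j k
  i_eq : σ.ireg .i = i
  row_eq : σ.ireg .row = n * i
  tab_eq : σ.ireg .tab = q
  matrix_le : n * n ≤ q
  isTable : IsTable A hA S w (c + 1) i ((c + 1) ^ (w + 1)) σ.cmem q

theorem HasTable.openTable_ensures (hSc : ∀ v, S v ≤ c) (h : HasTable A hA S w c (i + 1) p σ) :
    openTable.Ensures σ (c * 21 + 53) fun τ =>
      Filling A hA S w c i p (p + (c + 1) ^ (w + 1)) 0 τ ∧ τ.ireg .y = 0 ∧
        τ.ireg .tab = p + (c + 1) ^ (w + 1) := by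
  refine (LoopHaf.openTable_ensures h.toReady h.i_eq i.2 hSc).mono le_rfl
    fun τ hτ ⟨hi, hrow, hprev, htab, hpos, hy⟩ => ?_
  rw [h.tab_eq] at hprev htab hpos
  rw [h.row_eq, Nat.mul_add_one, Nat.add_sub_cancel] at hrow
  exact ⟨{ h.toReady.of_agree hτ with
    matrix_eq := hτ.cmem_eq rfl ▸ h.matrix_eq
    i_eq := hi
    row_eq := hrow
    pos_eq := hpos
    prev_eq := hprev
    matrix_le := h.matrix_le
    prev_le := le_rfl
    isTable_prev := hτ.cmem_eq rfl ▸ h.isTable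
    isTable := isTable_zero }, hy, htab⟩

theorem HasTable.computeTable_ensures (hband : IsBanded A w) (hSc : ∀ v, S v ≤ c)
    (hS : ∀ v ≥ n, S v = 0) (h : HasTable A hA S w c (i + 1) p σ) :
    computeTable.Ensures σ
      ((c + 1) ^ w * (c * (w * (c * 52 + 49) + 58) + 34) + c * 21 + 67)
      (HasTable A hA S w c i (p + (c + 1) ^ (w + 1))) := by
  refine Stmt.Ensures.seq (t' := (c + 1) ^ w * (c * (w * (c * 52 + 49) + 58) + 34) + 14)
    (h.openTable_ensures hSc) (fun τ _ ⟨hfill, hy, htab⟩ => ?_) (by omega)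
  refine Stmt.Ensures.loop (t := c * (w * (c * 52 + 49) + 58) + 29)
    (I := fun y υ => Filling A hA S w c i p (p + (c + 1) ^ (w + 1)) ((c + 1) * y) υ ∧
      υ.ireg IVar.y = y)
    (hfill.eval_powCell hfill.w_eq w.le_succ) ⟨hfill, hy⟩ (fun y υ hy _ ⟨hfill, hy'⟩ =>
      hfill.computeBlock_ensures hband hSc hS hy' hy) le_rfl fun υ hυ ⟨hfill, _⟩ => ?_
  exact { hfill with
    tab_eq := (hυ.ireg_eq .tab (by decide)).trans htab
    matrix_le := h.matrix_le.trans (Nat.le_add_right ..)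
    isTable := (pow_succ' (c + 1) w) ▸ hfill.isTable }

end Filling

theorem computeMax_ensures (hn : σ.ireg .n = n) :
    computeMax.Ensures σ (n * 22 + 11) fun τ => τ.ireg .c = (Finset.range n).sup σ.imem := by
  refine Stmt.Ensures.seq (t := 6) (t' := n * 22 + 5)
    (Q := fun τ => τ.ireg IVar.c = 0 ∧ τ.ireg .e = 0) ⟨⟨rfl, rfl⟩, le_rfl⟩
    (fun τ hτ ⟨hc, he⟩ => ?_) le_rfl
  refine Stmt.Ensures.loop (t := 17) (k := n)
    (I := fun j τ => τ.ireg IVar.c = (Finset.range j).sup σ.imem ∧ τ.ireg .e = j)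
    ((hτ.ireg_eq .n (by decide)).trans hn) ⟨by simp [hc], he⟩
    (fun j υ _ hυ ⟨hc, he⟩ => ⟨⟨?_, ?_⟩, le_rfl⟩) le_rfl fun _ _ => And.left
  · have hmem : υ.imem = σ.imem := (hυ.imem_eq rfl).trans (hτ.imem_eq rfl)
    simp [Stmt.exec, hc, he, hmem, Finset.range_add_one, sup_comm, add_tsub_eq_max]
  · simp [Stmt.exec, he]

theorem storePower_ensures (hn : σ.ireg .n = n) (hw : σ.ireg .w = w) (hc : σ.ireg .c = c) {e : ℕ}
    (he : σ.ireg .e = e) (hpow : σ.ireg .pow = (c + 1) ^ e) :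
    storePower.Ensures σ (c * 12 + 28) fun τ => τ.ireg .e = e + 1 ∧
      τ.ireg .pow = (c + 1) ^ (e + 1) ∧
        τ.imem = Function.update σ.imem (n + w + 1 + e) ((c + 1) ^ e) := by
  refine Stmt.Ensures.seq (t := 17) (t' := c * 12 + 11)
    (Q := fun τ => τ.ireg IVar.step = (c + 1) ^ e ∧
      τ.imem = Function.update σ.imem (n + w + 1 + e) ((c + 1) ^ e))
    ⟨by simp [Stmt.exec, hn, hw, he, hpow], le_rfl⟩ (fun τ hτ ⟨hstep, hmem⟩ => ?_) le_rfl
  refine Stmt.Ensures.seq (t := c * 12 + 5) (t' := 6)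
    (Q := fun υ => υ.ireg IVar.pow = (c + 1) ^ e + c * (c + 1) ^ e)
    (Stmt.Ensures.loop (t := 7)
      (I := fun j υ => υ.ireg IVar.pow = (c + 1) ^ e + j * (c + 1) ^ e)
      ((hτ.ireg_eq .c (by decide)).trans hc) (by simp [hτ.ireg_eq .pow (by decide), hpow])
      (fun j υ _ hυ hpow => ⟨?_, le_rfl⟩) le_rfl fun _ _ => id)
    (fun υ hυ hpow => ⟨⟨?_, ?_, ?_⟩, le_rfl⟩) (by omega)
  · simp [Stmt.exec, hpow, (hυ.ireg_eq .step (by decide)).trans hstep, add_assoc, add_one_mul]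
  · simp [Stmt.exec, hυ.ireg_eq .e (by decide), hτ.ireg_eq .e (by decide), he]
  · simp [Stmt.exec, hpow]
    ring
  · exact (hυ.imem_eq rfl).trans hmem

theorem storePowers_ensures (hn : σ.ireg .n = n) (hw : σ.ireg .w = w) (hc : σ.ireg .c = c) :
    storePowers.Ensures σ ((w + 2) * (c * 12 + 33) + 13) (Ready n w c σ.imem) := by
  refine Stmt.Ensures.seq (t := 6) (t' := (w + 2) * (c * 12 + 33) + 7)
    (Q := fun τ => τ.ireg IVar.pow = 1 ∧ τ.ireg .e = 0) ⟨⟨rfl, rfl⟩, le_rfl⟩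
    (fun τ hτ ⟨hpow, he⟩ => ?_) le_rfl
  replace hn := (hτ.ireg_eq .n (by decide)).trans hn
  replace hw := (hτ.ireg_eq .w (by decide)).trans hw
  replace hc := (hτ.ireg_eq .c (by decide)).trans hc
  refine Stmt.Ensures.loop (t := c * 12 + 28) (k := w + 2)
    (I := fun j υ => υ.ireg IVar.e = j ∧ υ.ireg .pow = (c + 1) ^ j ∧
      (∀ v ≤ n + w, υ.imem v = σ.imem v) ∧ ∀ e < j, υ.imem (n + w + 1 + e) = (c + 1) ^ e)
    (by simp [hw]) ⟨he, by simp [hpow], fun v _ => by rw [hτ.imem_eq rfl], by simp⟩ ?_ le_rfl ?_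
  · rintro j υ - hυ ⟨he, hpow, hmult, hpows⟩
    refine (storePower_ensures ((hυ.ireg_eq .n (by decide)).trans hn)
      ((hυ.ireg_eq .w (by decide)).trans hw) ((hυ.ireg_eq .c (by decide)).trans hc) he hpow).mono
      le_rfl fun φ _ ⟨he', hpow', hmem⟩ => ⟨he', hpow', fun v hv => ?_, fun e he => ?_⟩
    · rw [hmem, Function.update_of_ne (by omega), hmult v hv]
    · rw [hmem]
      rcases Nat.lt_succ_iff_lt_or_eq.1 he with he | rfl
      · rw [Function.update_of_ne (by omega), hpows e he]
      · rw [Function.update_self]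
  · rintro υ hυ ⟨-, -, hmult, hpows⟩
    exact ⟨(hυ.ireg_eq .n (by decide)).trans hn, (hυ.ireg_eq .w (by decide)).trans hw,
      (hυ.ireg_eq .c (by decide)).trans hc, hmult, fun e he => hpows e (Nat.lt_succ_of_le he)⟩

variable {A : Matrix (Fin n) (Fin n) ℂ} {hA : A.IsSymm}

theorem storeLastTable_ensures (h : Ready n w c S σ)
    (hmat : ∀ j k : Fin n, σ.cmem (n * j + k) = A j k) (hS : ∀ v ≥ n, S v = 0) :
    storeLastTable.Ensures σ (n * 12 + 20) (HasTable A hA S w c n (n * n)) := by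
  refine Stmt.Ensures.seq (t := 3) (t' := n * 12 + 17) (Q := fun τ => τ.ireg IVar.tab = 0)
    ⟨rfl, le_rfl⟩ (fun τ hτ htab => ?_) le_rfl
  refine Stmt.Ensures.seq (t := n * 12 + 5) (t' := 12)
    (Q := fun υ => υ.ireg IVar.tab = n * n)
    (Stmt.Ensures.loop (t := 7) (I := fun j υ => υ.ireg IVar.tab = j * n)
      (h.of_agree hτ).n_eq (by simp [htab]) (fun j υ _ hυ htab => ⟨?_, le_rfl⟩) le_rfl
      fun _ _ => id)
    (fun υ hυ htab => ⟨?_, le_rfl⟩) (by omega)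
  · simp [Stmt.exec, htab, ((h.of_agree hτ).of_agree hυ).n_eq, add_one_mul]
  · replace h := (h.of_agree hτ).of_agree hυ
    exact { h with
      matrix_eq := fun j k => by
        simp [Stmt.exec, htab, (mul_add_lt_mul_self j k).ne, hυ.cmem_eq rfl, hτ.cmem_eq rfl, hmat]
      i_eq := h.n_eq
      row_eq := htab
      tab_eq := htab
      matrix_le := le_rfl
      isTable := isTable_last hS (by simp [Stmt.exec, htab]) }

theorem HasTable.computeTables_ensures (h : HasTable A hA S w c n (n * n) σ) (hband : IsBanded A w)
    (hSc : ∀ v, S v ≤ c) (hS : ∀ v ≥ n, S v = 0) :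
    computeTables.Ensures σ
      (n * ((c + 1) ^ w * (c * (w * (c * 52 + 49) + 58) + 34) + c * 21 + 72) + 5)
      (HasTable A hA S w c 0 (n * n + n * (c + 1) ^ (w + 1))) := by
  refine Stmt.Ensures.loop
    (t := (c + 1) ^ w * (c * (w * (c * 52 + 49) + 58) + 34) + c * 21 + 67)
    (I := fun j => HasTable A hA S w c (n - j) (n * n + j * (c + 1) ^ (w + 1))) h.n_eq
    (by simpa using h) (fun j υ hj _ h => ?_) le_rfl fun υ _ h => by simpa using h
  have hi : n - j = n - (j + 1) + 1 := by omega
  rw [hi] at h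
  rw [add_one_mul, ← add_assoc]
  exact HasTable.computeTable_ensures (i := ⟨n - (j + 1), by omega⟩) hband hSc hS h

theorem HasTable.readResult_ensures {q : ℕ} (h : HasTable A hA S w c 0 q σ) (hSc : ∀ v, S v ≤ c) :
    readResult.Ensures σ ((w + 1) * (c * 21 + 17) + 19) fun τ =>
      τ.creg .out = repeatedLhaf A hA S := by
  refine Stmt.Ensures.seq (t := 7) (t' := (w + 1) * (c * 21 + 17) + 12)
    (Q := fun τ => τ.ireg IVar.pos = q ∧ τ.ireg .e = 0) ⟨⟨h.tab_eq, rfl⟩, le_rfl⟩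
    (fun τ hτ ⟨hpos, he⟩ => ?_) le_rfl
  refine Stmt.Ensures.seq (t := (w + 1) * (c * 21 + 17) + 7) (t' := 5)
    (Q := fun υ => υ.ireg IVar.pos = q + windowCode (c + 1) 0 (w + 1) S)
    (Stmt.Ensures.loop (t := c * 21 + 12) (k := w + 1)
      (I := fun k υ => υ.ireg IVar.pos = q + windowCode (c + 1) 0 k S ∧ υ.ireg .e = k)
      (by simp [(h.toReady.of_agree hτ).w_eq]) ⟨by simp [hpos, windowCode], he⟩ ?_ le_rfl
      fun _ _ => And.left)
    (fun υ hυ hpos => ⟨?_, le_rfl⟩) (by omega)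
  · rintro k υ hk hυ ⟨hpos, he⟩
    replace h := (h.toReady.of_agree hτ).of_agree hυ
    refine Stmt.Ensures.seq (t := c * 21 + 6) (t' := 6)
      (Q := fun φ => φ.ireg IVar.pos = υ.ireg .pos + S k * (c + 1) ^ k)
      (Stmt.Ensures.loop (t := 16) (k := S k)
        (I := fun j φ => φ.ireg IVar.pos = υ.ireg .pos + j * (c + 1) ^ k)
        (by simp [he, h.mult_eq k (by omega)]) (by simp) (fun j φ _ hφ hpos => ⟨?_, le_rfl⟩)
        (Nat.add_le_add_right (Nat.mul_le_mul_right 21 (hSc k)) 6) fun _ _ => id)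
      (fun φ hφ hpos' => ⟨⟨?_, ?_⟩, le_rfl⟩) (by omega)
    · have hpow : (powCell IVar.e).eval φ = (c + 1) ^ k :=
        (h.of_agree hφ).eval_powCell ((hφ.ireg_eq .e (by decide)).trans he) hk.le
      simp [Stmt.exec, hpow, hpos, add_assoc, add_one_mul]
    · simp [Stmt.exec, windowCode_succ_right, hpos', hpos, add_assoc]
    · simp [Stmt.exec, (hφ.ireg_eq .e (by decide)).trans he]
  · have hS : InWindow S w 0 S :=
      ⟨le_rfl, fun _ hv => absurd hv (Nat.not_lt_zero _), fun _ _ => rfl⟩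
    simp [Stmt.exec, hpos, hυ.cmem_eq rfl, hτ.cmem_eq rfl, h.isTable S hS
      (windowCode_lt fun v => Nat.lt_add_one_of_le (hSc v))]

/-- The bound for the number of steps that `loopHafnian_ensures` proves; `c` is the largest
multiplicity. -/
def loopHafnianTime (n w c : ℕ) : ℕ :=
  (w + 1) * (c * 21 + 17) + 19 +
      (n * ((c + 1) ^ w * (c * (w * (c * 52 + 49) + 58) + 34) + c * 21 + 72) + 5) +
    (n * 12 + 20) + ((w + 2) * (c * 12 + 33) + 13) + (n * 22 + 11)

theorem loopHafnian_ensures (hn : σ.ireg .n = n) (hw : σ.ireg .w = w)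
    (hmat : ∀ j k : Fin n, σ.cmem (n * j + k) = A j k) (hband : IsBanded A w)
    (hS : ∀ v ≥ n, σ.imem v = 0) (hc : (Finset.range n).sup σ.imem = c) :
    loopHafnian.Ensures σ (loopHafnianTime n w c) fun τ =>
      τ.creg .out = repeatedLhaf A hA σ.imem := by
  have hSc (v : ℕ) : σ.imem v ≤ c := by
    rcases lt_or_ge v n with hv | hv
    · exact hc ▸ Finset.le_sup (Finset.mem_range.2 hv)
    · exact (hS v hv).trans_le (Nat.zero_le c)
  refine Stmt.Ensures.seq (computeMax_ensures hn) (fun τ hτ hc' => ?_) le_rfl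
  refine Stmt.Ensures.seq (storePowers_ensures ((hτ.ireg_eq .n (by decide)).trans hn)
    ((hτ.ireg_eq .w (by decide)).trans hw) (hc'.trans hc)) (fun υ hυ hready => ?_) le_rfl
  rw [hτ.imem_eq rfl] at hready
  refine Stmt.Ensures.seq (storeLastTable_ensures (hA := hA) hready
    (by rwa [hυ.cmem_eq rfl, hτ.cmem_eq rfl]) hS) (fun _ _ h => ?_) le_rfl
  refine Stmt.Ensures.seq (h.computeTables_ensures hband hSc hS) (fun _ _ h => ?_) le_rfl
  exact h.readResult_ensures hSc

end Specification

end Algorithm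

section Conclusion

variable {n : ℕ} (w : ℕ) (s : Fin n → ℕ) (A : Matrix (Fin n) (Fin n) ℂ)

theorem cmem_inputConfig (j k : Fin n) : (inputConfig n w s A).cmem (n * j + k) = A j k := by
  have h := mul_add_lt_mul_self j k
  have hn : 0 < n := j.pos
  simp [inputConfig, h, Fin.divNat, Fin.modNat, Nat.mul_add_div hn, Nat.div_eq_of_lt k.2,
    Nat.mod_eq_of_lt k.2]

theorem imem_inputConfig (i : Fin n) : (inputConfig n w s A).imem i = s i := by
  simp [inputConfig]

theorem imem_inputConfig_of_le {v : ℕ} (hv : n ≤ v) : (inputConfig n w s A).imem v = 0 := by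
  simp [inputConfig, hv]

theorem sup_imem_inputConfig :
    (Finset.range n).sup (inputConfig n w s A).imem = Finset.univ.sup s := by
  rw [← Nat.Iio_eq_range, ← Fin.map_valEmbedding_univ, Finset.sup_map]
  exact Finset.sup_congr rfl fun i _ => imem_inputConfig w s A i

variable {s A w}

theorem repeatedLhaf_eq (hA : A.IsSymm) {m : ℕ → ℕ} (hm : ∀ i : Fin n, m i = s i) :
    repeatedLhaf A hA m = lhaf (repeated A s) (repeated_isSymm hA s) := by
  obtain rfl : (fun i : Fin n => m i) = s := funext hm
  rfl

theorem haltsWith_loopHafnian (hA : A.IsSymm) (hband : IsBanded A w) :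
    ∃ t ≤ loopHafnianTime n w (Finset.univ.sup s),
      HaltsWith (loopHafnian.compile layout layout.bound 0) (inputConfig n w s A) t
        (lhaf (repeated A s) (repeated_isSymm hA s)) := by
  obtain ⟨hout, htime⟩ := loopHafnian_ensures (hA := hA) (σ := layout.view (inputConfig n w s A))
    rfl rfl (cmem_inputConfig w s A) hband (fun _ => imem_inputConfig_of_le w s A)
    (sup_imem_inputConfig w s A)
  have hval := hout.trans (repeatedLhaf_eq hA (imem_inputConfig w s A))
  exact ⟨_, htime, hval ▸ Stmt.haltsWith_compile loopHafnian layout rfl rfl⟩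

end Conclusion

section Time

variable {n : ℕ} (w c : ℕ)

theorem loopHafnianTime_le (hn : 0 < n) :
    loopHafnianTime n w c ≤ 300 * (n * ((c + 1) ^ (w + 1) * (w * (c + 1) + 1))) := by
  set p := (c + 1) ^ w
  set a := c * (w * (c * 52 + 49) + 58) + 34
  set b := c * 21 + 106
  set d := (w + 2) * (c * 12 + 33) + (w + 1) * (c * 21 + 17) + 68
  have hsum : a + b + d ≤ 300 * ((c + 1) * (w * (c + 1) + 1)) := by
    have (x : ℕ) : 0 ≤ x := x.zero_le
    simp only [a, b, d]
    nlinarith [this (w * c ^ 2), this (w * c)]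
  have hp0 : 0 < p := Nat.pow_pos c.succ_pos
  calc loopHafnianTime n w c
    _ = n * (p * a + b) + d := by
      rw [loopHafnianTime]
      ring
    _ ≤ n * (p * a + p * b) + n * (p * d) := by
      gcongr
      · exact Nat.le_mul_of_pos_left b hp0
      · exact (Nat.le_mul_of_pos_left d hp0).trans (Nat.le_mul_of_pos_left _ hn)
    _ = n * (p * (a + b + d)) := by ring
    _ ≤ n * (p * (300 * ((c + 1) * (w * (c + 1) + 1)))) := by gcongr
    _ = 300 * (n * ((c + 1) ^ (w + 1) * (w * (c + 1) + 1))) := by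
      rw [pow_succ]
      ring

theorem pow_mul_le_pow_mul_log :
    (c + 1) ^ (w + 1) * (w * (c + 1) + 1) ≤
      (2 * c + 2) ^ (2 * w + 1) * Nat.log 2 ((2 * c + 2) ^ (2 * w + 1)) := by
  have hfactor : w * (c + 1) + 1 ≤ (w + 1) * (c + 1) ^ w := by
    rcases w.eq_zero_or_pos with rfl | hw
    · simp
    · rw [add_one_mul]
      gcongr
      · exact Nat.le_self_pow hw.ne' _
      · exact Nat.pow_pos c.succ_pos
  have hlog : w + 1 ≤ Nat.log 2 ((2 * c + 2) ^ (2 * w + 1)) :=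
    Nat.le_log_of_pow_le one_lt_two <|
      (Nat.pow_le_pow_right two_pos (by omega)).trans (Nat.pow_le_pow_left (by omega) _)
  calc (c + 1) ^ (w + 1) * (w * (c + 1) + 1)
    _ ≤ (c + 1) ^ (w + 1) * ((w + 1) * (c + 1) ^ w) := by gcongr
    _ = (c + 1) ^ (2 * w + 1) * (w + 1) := by ring
    _ ≤ _ := Nat.mul_le_mul (Nat.pow_le_pow_left (by omega) _) hlog

end Time
end LoopHaf

theorem mainTheorem3_general :
    ∃ (P : LoopHaf.Program) (K : ℕ),
      ∀ (n w c : ℕ) (A : Matrix (Fin n) (Fin n) ℂ) (s : Fin n → ℕ) (hA : A.IsSymm),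
        0 < n → LoopHaf.IsBanded A w → c = Finset.univ.sup s →
        ∃ t ≤ K * (n * ((c + 1) ^ (w + 1) * (w * (c + 1) + 1))),
          LoopHaf.HaltsWith P (LoopHaf.inputConfig n w s A) t
            (LoopHaf.lhaf (LoopHaf.repeated A s) (LoopHaf.repeated_isSymm hA s)) := by
  refine ⟨LoopHaf.loopHafnian.compile LoopHaf.layout LoopHaf.layout.bound 0, 300, ?_⟩
  rintro n w c A s hA hn hband rfl
  obtain ⟨t, ht, h⟩ := LoopHaf.haltsWith_loopHafnian hA hband (s := s)
  exact ⟨t, ht.trans (LoopHaf.loopHafnianTime_le w _ hn), h⟩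

/-- A single program computes `lhaf(A_s)` in time `O*(n (2c+2)^(2w+1))` with `c = max s_i`; the
factor that `O*` hides is polylogarithmic in `(2c+2)^(2w+1)`, that is, polynomial in `w` and
`log c`. -/
theorem mainTheorem3 :
    ∃ (P : LoopHaf.Program) (K k : ℕ),
      ∀ (n w c : ℕ) (A : Matrix (Fin n) (Fin n) ℂ) (s : Fin n → ℕ) (hA : A.IsSymm),
        0 < n → LoopHaf.IsBanded A w → (∀ i, 0 < s i) → c = Finset.univ.sup s →
        ∃ t : ℕ,
          t ≤ K * (n * (2 * c + 2) ^ (2 * w + 1)) * Nat.log 2 ((2 * c + 2) ^ (2 * w + 1)) ^ k ∧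
          LoopHaf.HaltsWith P (LoopHaf.inputConfig n w s A) t
            (LoopHaf.lhaf (LoopHaf.repeated A s) (LoopHaf.repeated_isSymm hA s)) := by
  obtain ⟨P, K, hP⟩ := mainTheorem3_general
  refine ⟨P, K, 1, fun n w c A s hA hn hband _ hc => ?_⟩
  obtain ⟨t, ht, h⟩ := hP n w c A s hA hn hband hc
  rw [pow_one, mul_assoc, mul_assoc]
  exact ⟨t, ht.trans (Nat.mul_le_mul_left K
    (Nat.mul_le_mul_left n (LoopHaf.pow_mul_le_pow_mul_log w c))), h⟩
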